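/- **Setting.** Fix a horizon $H$, a state space $\mathcal S$, an action space $\mathcal A$ (measurable spaces) and an initial state $s_1$. An MDP $M=(P,R)$ consists of transition kernels $P_h:\mathcal S\times\mathcal A\to\Delta(\mathcal S)$ and rewards $R_h:\mathcal S\times\mathcal A\to[0,1]$, $h=1,\dots,H$ (equivalently, the step may be regarded as part of the state). A policy $\pi$ selects $a_h=\pi_h(s_h)$; write $M(\cdot|\pi)$ for the law of the trajectory $o=(s_h,a_h,r_h)_{h\le H}$, $r_h=R_h(s_h,a_h)$, started at $s_1$, and $V_M(\pi)=\mathbb E_{o\sim M(\cdot|\pi)}[\sum_{h=1}^H r_h]$. Let $Q_h^\pi(s,a;M)$, $V_h^\pi(s;M)$ be the usual value functions. Let $\Pi$ be a finite set of policies and $\mathcal M$ a finite set of MDPs such that for every $M\in\mathcal M$: (i) under every policy $\sum_{h=1}^H r_h\le 1$ almost surely, and $Q_h^\pi(s,a;M)\le 1$ for all $\pi,h,s,a$; (ii) $\Pi$ contains an optimal policy $\pi_M$ of $M$ (optimal from every state at every step); write $Q^\star_h(\cdot;M)=Q^{\pi_M}_h(\cdot;M)$ and $V_h^\star(\cdot;M)=V_h^{\pi_M}(\cdot;M)$.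 Assume the linear $Q^\star/V^\star$ condition: there are features $\varphi_h:\mathcal S\times\mathcal A\to\mathbb R^d$, $\psi_h:\mathcal S\to\mathbb R^d$ and a finite set $\mathcal F\subset\mathbb R^d\times\mathbb R^d$ such that for every $M\in\mathcal M$ there is $(\theta,w)\in\mathcal F$ with $Q^\star_h(s,a;M)=\varphi_h(s,a)^\top\theta$ and $V^\star_h(s;M)=\psi_h(s)^\top w$ for all $h\le H$, $s$, $a$. Let $\Phi=\{\phi_{\theta,w}:(\theta,w)\in\mathcal F\}$ with $$\phi_{\theta,w}=\{(M,\pi_M): M\in\mathcal M,\ Q^\star_h(s,a;M)=\varphi_h(s,a)^\top\theta,\ V^\star_h(s;M)=\psi_h(s)^\top w\ \ \forall h\le H,s,a\},$$ and let $\bar{\mathcal M}(\Phi)=\bigcup_{\phi\in\Phi}\mathrm{co}\{M(\cdot|\cdot): M\in\mathcal M,\ \exists\pi,\ (M,\pi)\in\phi\}$ be the class of mixtures of models within a group (each regarded as a map $\Pi\to\Delta(\text{trajectories})$, the value $V_M(\pi)$ of a mixture again being the expected total reward). For a class $\mathcal N$ of such maps and $\eta>0$ let $$\mathsf{DEC}^{\mathrm{KL}}_\eta(\mathcal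 N)=\sup_{\bar M\in\mathrm{co}(\mathcal N)}\ \inf_{p\in\Delta(\Pi)}\ \sup_{M\in\mathcal N}\ \mathbb E_{\pi\sim p}\Big[\max_{\pi'\in\Pi}V_M(\pi')-V_M(\pi)-\tfrac1\eta\,\mathrm{KL}\big(M(\cdot|\pi),\bar M(\cdot|\pi)\big)\Big].$$ **Theorem.** For every $\eta>0$, $\ \mathsf{DEC}^{\mathrm{KL}}_\eta(\bar{\mathcal M}(\Phi))\le 4\eta dH^2$. -/

import Mathlib

open MeasureTheory ProbabilityTheory
open scoped NNReal ENNReal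

noncomputable section

namespace LinearQV

/-! ### Decision making problems and the decision-estimation coefficient

A model with policy class `Pol` and observation space `O` is a map `M : Pol → Measure O`, where
`M π` is the law of the observation when `π` is executed.  The reward of an observation `o` is
`rew o`, so the value of `π` in `M` is the expectation of `rew` under `M π`. -/

section DEC

variable {Pol O : Type*} [Fintype Pol] [MeasurableSpace O]

/-- The value `V_M(π)`: the expected reward of the policy `π` in the model `M`. -/
def value (rew : O → ℝ) (M : Pol → Measure O) (π : Pol) : ℝ :=
  ∫ o, rew o ∂(M π)

/-- `𝔼_{π ∼ p} [V_M(π_M) - V_M(π) - (1/η) KL(M(·|π), M̄(·|π))]`, where `V_M(π_M) = max_π V_M(π)`.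
It is extended-real valued, since the relative entropy may be `∞` (the value is then `-∞`, unless
`p` gives no mass to such policies). -/
def decPayoff (rew : O → ℝ) (η : ℝ) (Mbar M : Pol → Measure O) (p : Pol → ℝ) : EReal :=
  ((∑ π, p π * ((⨆ π', value rew M π') - value rew M π) : ℝ) : EReal) -
    ((∑ π, ENNReal.ofReal (p π / η) * InformationTheory.klDiv (M π) (Mbar π) : ℝ≥0∞) : EReal)

/-- The offset decision-estimation coefficient with relative entropy of a model class:
`sup_{M̄ ∈ co(𝓜)} inf_{p ∈ Δ(Pol)} sup_{M ∈ 𝓜}` of `decPayoff`. -/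
def decKL (rew : O → ℝ) (η : ℝ) (models : Set (Pol → Measure O)) : EReal :=
  ⨆ Mbar ∈ convexHull ℝ≥0 models, ⨅ p ∈ stdSimplex ℝ Pol, ⨆ M ∈ models,
    decPayoff rew η Mbar M p

/-- The `Φ`-aware convexification `⋃_{φ ∈ Φ} co {M ∈ 𝓜 | ∃ π, (M, π) ∈ φ}`.  Models are presented
by the elements of a type `𝓘` (for instance MDPs), with `law M` the model presented by `M`. -/
def convexification {𝓘 : Type*} (law : 𝓘 → Pol → Measure O) (models : Set 𝓘)
    (Φ : Set (Set (𝓘 × Pol))) : Set (Pol → Measure O) :=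
  ⋃ φ ∈ Φ, convexHull ℝ≥0 (law '' {M | M ∈ models ∧ ∃ π, (M, π) ∈ φ})

end DEC

/-! ### Finite-horizon Markov decision processes

Steps are numbered `0, …, H - 1`.  Transitions, rewards and policies may depend on the step;
equivalently, the step is part of the state.  Only the data of the steps `h < H` matters. -/

section MDPs

/-- A deterministic Markov policy. -/
structure Policy (S A : Type*) [MeasurableSpace S] [MeasurableSpace A] where
  act : ℕ → S → A
  measurable_act : ∀ h, Measurable (act h)

/-- The transition kernels and the `[0,1]`-valued reward functions of an MDP. -/
structure MDP (S A : Type*) [MeasurableSpace S] [MeasurableSpace A] where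
  P : ℕ → Kernel (S × A) S
  markov : ∀ h, IsMarkovKernel (P h)
  R : ℕ → S × A → ℝ
  measurable_R : ∀ h, Measurable (R h)
  R_mem : ∀ h x, R h x ∈ Set.Icc (0 : ℝ) 1

variable {S A : Type*} [MeasurableSpace S] [MeasurableSpace A]

/-- The transition kernel of step `h` under a policy. -/
def MDP.next (M : MDP S A) (π : Policy S A) (h : ℕ) : Kernel S S :=
  (M.P h).comap (fun s => (s, π.act h s)) (measurable_id.prodMk (π.measurable_act h))

/-- The expected reward collected by `π` in the `n` steps `h, …, h + n - 1` from state `s`. -/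
def MDP.rewardToGo (M : MDP S A) (π : Policy S A) : ℕ → ℕ → S → ℝ
  | 0, _, _ => 0
  | n + 1, h, s => M.R h (s, π.act h s) + ∫ s', M.rewardToGo π n (h + 1) s' ∂(M.next π h s)

/-- The value function `V_h^π(s)` with horizon `H`. -/
def MDP.V (M : MDP S A) (H : ℕ) (π : Policy S A) (h : ℕ) (s : S) : ℝ :=
  M.rewardToGo π (H - h) h s

/-- The action-value function `Q_h^π(s, a)` with horizon `H` (for `h < H`). -/
def MDP.Q (M : MDP S A) (H : ℕ) (π : Policy S A) (h : ℕ) (s : S) (a : A) : ℝ :=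
  M.R h (s, a) + ∫ s', M.V H π (h + 1) s' ∂(M.P h (s, a))

/-- `π` is an optimal policy: it maximizes the value at every step and state. -/
def MDP.IsOptimal (M : MDP S A) (H : ℕ) (π : Policy S A) : Prop :=
  ∀ (π' : Policy S A), ∀ h < H, ∀ s, M.V H π' h s ≤ M.V H π h s

/-- A trajectory `(s_h, a_h, r_h)_h` of `n` steps. -/
abbrev Traj (S A : Type*) (n : ℕ) : Type _ := Fin n → S × A × ℝ

/-- The total reward of a trajectory. -/
def totalReward {S A : Type*} {n : ℕ} (o : Traj S A n) : ℝ := ∑ h, (o h).2.2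

/-- The law of the trajectory of `n` steps that `π` generates from step `h`, as a kernel in the
state at step `h`. -/
def MDP.trajKernel (M : MDP S A) (π : Policy S A) : (n : ℕ) → ℕ → Kernel S (Traj S A n)
  | 0, _ => Kernel.deterministic (fun _ => Fin.elim0) measurable_const
  | n + 1, h =>
    (Kernel.id ×ₖ (M.trajKernel π n (h + 1) ∘ₖ M.next π h)).map
      (fun x => Fin.cons (x.1, π.act h x.1, M.R h (x.1, π.act h x.1)) x.2)

/-- The law of the full trajectory (the observation) from the initial state `s₁`. -/
def MDP.trajLaw (M : MDP S A) (H : ℕ) (s₁ : S) (π : Policy S A) : Measure (Traj S A H) :=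
  M.trajKernel π H 0 s₁

/-- Normalization of the rewards: for every policy the total reward of an episode is almost surely
at most one, and the action-value functions (at all states) are at most one. -/
def MDP.Normalized (M : MDP S A) (H : ℕ) (s₁ : S) : Prop :=
  (∀ π : Policy S A, ∀ᵐ o ∂(M.trajLaw H s₁ π), totalReward o ≤ 1) ∧
    ∀ π : Policy S A, ∀ h < H, ∀ s a, M.Q H π h s a ≤ 1

/-- Given that `π` is optimal in `M`: `Q*(s, a; M) = ⟨φ(s, a), θ⟩` and `V*(s; M) = ⟨ψ(s), w⟩`. -/
def MDP.HasParam (M : MDP S A) (H : ℕ) (π : Policy S A) {d : ℕ}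
    (φ : ℕ → S → A → EuclideanSpace ℝ (Fin d)) (ψ : ℕ → S → EuclideanSpace ℝ (Fin d))
    (f : EuclideanSpace ℝ (Fin d) × EuclideanSpace ℝ (Fin d)) : Prop :=
  ∀ h < H, ∀ s, (∀ a, M.Q H π h s a = inner ℝ (φ h s a) f.1) ∧ M.V H π h s = inner ℝ (ψ h s) f.2

/-- The group `φ_{θ,w}` of the pairs `(M, π_M)`, `M ∈ 𝓜`, with parameters `f = (θ, w)`. -/
def group (H : ℕ) {Pol : Finset (Policy S A)} (models : Set (MDP S A)) (opt : MDP S A → Pol)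
    {d : ℕ} (φ : ℕ → S → A → EuclideanSpace ℝ (Fin d)) (ψ : ℕ → S → EuclideanSpace ℝ (Fin d))
    (f : EuclideanSpace ℝ (Fin d) × EuclideanSpace ℝ (Fin d)) : Set (MDP S A × Pol) :=
  {x | x.1 ∈ models ∧ x.2 = opt x.1 ∧ x.1.HasParam H (opt x.1) φ ψ f}

end MDPs

end LinearQV

end

/-! Fix the reference `Mbar`. Hahn–Banach separation swaps the inner infimum and supremum: it is
enough that, for every finite prior `ρ` on models at finite relative entropy from `Mbar`, some
policy has averaged payoff at most the bound (`exists_stdSimplex_forall_sum_le`,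
`iInf_iSup_decPayoff_le`). Posterior sampling provides one: draw `g` from `ρ` and play the policy `σ
g` that is greedy for the value functions of model `g`.

A mixture of MDPs is in general not an MDP. But the models of a group share `Q*` and `V*`, and the
averaged Bellman equations are linear in the trajectory law, so they survive mixing
(`IsConsistent`). They suffice to bound every value by `V 0 s₁`. As the draw `g` and the model `i`
have the same law, the expected regret equals `∑ h, ∑ g, ρ g * E h g g`, where `E h g i` is the mean
Bellman error of the pair `(Q i, V i)` at step `h` when `σ g` is run in the prior mixture
(`sum_sub_value_eq`).

For each `h` this is a trace. The Bellman error is linear in `(θ, w, 1)`, so the matrix has rank at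
most `2d+1` and its squared trace is at most `2d+1` times its squared Frobenius norm
(`sq_sum_apply_le`). Since the Bellman error of `i` has mean zero in model `i` itself, Pinsker's
inequality bounds the entries by the relative entropy from model `i` to the mixture; on average this
is no larger than the one to `Mbar` (`sum_sq_integral_mixture_le`). Summing over `h` and applying
AM–GM trades the square root against the `1/η` penalty. -/

namespace LinearQV

open InformationTheory

/-! ### Relative entropy: Pinsker's inequality and finite mixtures -/

section KL

variable {Ω : Type*} {mΩ : MeasurableSpace Ω}

/-- The Donsker–Varadhan lower bound of the relative entropy. -/
lemma integral_sub_log_integral_exp_le_klDiv {μ ν : Measure Ω} [IsProbabilityMeasure μ]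
    [IsProbabilityMeasure ν] (h : klDiv μ ν ≠ ∞) {f : Ω → ℝ} (hfμ : Integrable f μ)
    (hfν : Integrable (fun x => Real.exp (f x)) ν) :
    ∫ x, f x ∂μ - Real.log (∫ x, Real.exp (f x) ∂ν) ≤ (klDiv μ ν).toReal := by
  obtain ⟨hac, hint⟩ := klDiv_ne_top_iff.1 h
  -- Gibbs' inequality for `μ` against the exponential tilt of `ν` by `f`; expanding the
  -- log-likelihood ratio gives the claim.
  have := isProbabilityMeasure_tilted hfν
  have hac' : μ ≪ ν.tilted f := hac.trans (absolutelyContinuous_tilted hfν)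
  have h0 := integral_llr_add_sub_measure_univ_nonneg hac'
    (integrable_llr_tilted_right hac hfμ hint hfν)
  rw [integral_llr_tilted_right hac hfμ hfν hint] at h0
  rw [toReal_klDiv hac hint]
  simp only [probReal_univ] at h0 ⊢
  linarith

/-- Pinsker's inequality, for the expectations of a bounded random variable. -/
lemma sq_integral_sub_integral_le_klDiv {μ ν : Measure Ω} [IsProbabilityMeasure μ]
    [IsProbabilityMeasure ν] (h : klDiv μ ν ≠ ∞) {X : Ω → ℝ} {a b : ℝ} (hab : a < b)
    (hm : AEMeasurable X ν) (hb : ∀ᵐ ω ∂ν, X ω ∈ Set.Icc a b) :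
    (∫ ω, X ω ∂ν - ∫ ω, X ω ∂μ) ^ 2 ≤ (b - a) ^ 2 / 2 * (klDiv μ ν).toReal := by
  have hac := (klDiv_ne_top_iff.1 h).1
  have hXμ : Integrable X μ := Integrable.of_mem_Icc a b (hm.mono_ac hac) (hac hb)
  -- Hoeffding's lemma: the centred variable is subgaussian with variance proxy `((b - a) / 2) ^ 2`.
  have hsub := hasSubgaussianMGF_of_mem_Icc hm hb
  set m := ∫ ω, X ω ∂ν with hmdef
  set D := ∫ ω, X ω ∂μ - m with hD
  set c : ℝ := ((b - a) / 2) ^ 2 with hc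
  have hcpos : 0 < c := by have : 0 < b - a := by linarith
                           positivity
  have key : ∀ t : ℝ, t * D - c * t ^ 2 / 2 ≤ (klDiv μ ν).toReal := by
    intro t
    have hexp := hsub.integrable_exp_mul t
    have h1 := integral_sub_log_integral_exp_le_klDiv h
      (f := fun ω => t * (X ω - m)) ((hXμ.sub (integrable_const m)).const_mul t) hexp
    have h2 : ∫ ω, t * (X ω - m) ∂μ = t * D := by
      rw [integral_const_mul, integral_sub hXμ (integrable_const m)]
      simp [hD]
    have h3 := hsub.mgf_le t
    have h4 : Real.log (∫ ω, Real.exp (t * (X ω - m)) ∂ν) ≤ c * t ^ 2 / 2 := by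
      have hpos : 0 < ∫ ω, Real.exp (t * (X ω - m)) ∂ν := integral_exp_pos hexp
      rw [Real.log_le_iff_le_exp hpos]
      refine h3.trans_eq ?_
      congr 3
      simp only [NNReal.coe_pow, NNReal.coe_div, coe_nnnorm, NNReal.coe_ofNat, hc]
      rw [Real.norm_of_nonneg (by linarith)]
    rw [h2] at h1
    linarith
  -- `t = D / c` maximizes the quadratic lower bound in `key`.
  have hk := key (D / c)
  have h5 : D / c * D - c * (D / c) ^ 2 / 2 = D ^ 2 / (2 * c) := by
    field_simp
    ring
  rw [h5, div_le_iff₀ (by positivity)] at hk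
  have h6 : (m - ∫ ω, X ω ∂μ) ^ 2 = D ^ 2 := by rw [hD]; ring
  rw [h6]
  refine hk.trans_eq ?_
  rw [hc]; ring

variable {ι : Type*} [Fintype ι]

/-- The mixture of finitely many measures. -/
noncomputable def mixture (ρ : ι → ℝ≥0) (P : ι → Measure Ω) : Measure Ω := ∑ i, ρ i • P i

lemma isProbabilityMeasure_mixture {ρ : ι → ℝ≥0} (hρ : ∑ i, ρ i = 1) (P : ι → Measure Ω)
    [∀ i, IsProbabilityMeasure (P i)] : IsProbabilityMeasure (mixture ρ P) := by
  constructor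
  simp only [mixture, Measure.coe_finsetSum, Finset.sum_apply, Measure.smul_apply, measure_univ]
  simp only [ENNReal.smul_def, smul_eq_mul, mul_one]
  exact_mod_cast hρ

lemma smul_le_mixture (ρ : ι → ℝ≥0) (P : ι → Measure Ω) (i : ι) : ρ i • P i ≤ mixture ρ P :=
  Finset.single_le_sum (f := fun i => ρ i • P i) (fun _ _ => Measure.zero_le _) (Finset.mem_univ i)

lemma absolutelyContinuous_mixture {ρ : ι → ℝ≥0} (P : ι → Measure Ω) {i : ι} (hi : ρ i ≠ 0) :
    P i ≪ mixture ρ P :=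
  (Measure.absolutelyContinuous_smul (ENNReal.coe_ne_zero.2 hi)).trans
    (Measure.absolutelyContinuous_of_le (smul_le_mixture ρ P i))

lemma mixture_absolutelyContinuous {ρ : ι → ℝ≥0} {P : ι → Measure Ω} {ν : Measure Ω}
    (h : ∀ i, P i ≪ ν) : mixture ρ P ≪ ν := by
  intro s hs
  simp only [mixture, Measure.coe_finsetSum, Finset.sum_apply, Measure.smul_apply]
  exact Finset.sum_eq_zero fun i _ => by simp [h i hs]

lemma ae_mixture {ρ : ι → ℝ≥0} {P : ι → Measure Ω} {p : Ω → Prop}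
    (h : ∀ i, ∀ᵐ ω ∂P i, p ω) : ∀ᵐ ω ∂mixture ρ P, p ω := by
  rw [ae_iff]
  simp only [mixture, Measure.coe_finsetSum, Finset.sum_apply, Measure.smul_apply]
  exact Finset.sum_eq_zero fun i _ => by simp [ae_iff.1 (h i)]

lemma integral_mixture {ρ : ι → ℝ≥0} {P : ι → Measure Ω} {f : Ω → ℝ}
    (h : ∀ i, ρ i ≠ 0 → Integrable f (P i)) :
    Integrable f (mixture ρ P) ∧ ∫ ω, f ω ∂mixture ρ P = ∑ i, ρ i * ∫ ω, f ω ∂P i := by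
  have h' : ∀ i ∈ Finset.univ, Integrable f (ρ i • P i) := by
    intro i _
    by_cases hi : ρ i = 0
    · simp [hi]
    · exact (h i hi).smul_measure_nnreal
  refine ⟨integrable_finsetSum_measure.2 h', ?_⟩
  rw [mixture, integral_finsetSum_measure h']
  refine Finset.sum_congr rfl fun i _ => ?_
  rw [integral_smul_nnreal_measure]
  rfl

/-- The mixture dominates `ρ i • P i`, so the density of `P i` is at most `(ρ i)⁻¹`, and `x log x`
is bounded on a compact interval. -/
lemma klDiv_mixture_ne_top {ρ : ι → ℝ≥0} (hρ : ∑ i, ρ i = 1) (P : ι → Measure Ω)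
    [∀ i, IsProbabilityMeasure (P i)] {i : ι} (hi : ρ i ≠ 0) : klDiv (P i) (mixture ρ P) ≠ ∞ := by
  have := isProbabilityMeasure_mixture hρ P
  have hac := absolutelyContinuous_mixture P hi
  refine klDiv_ne_top hac ?_
  rw [← integrable_rnDeriv_mul_log_iff hac]
  have hle : ∀ᵐ ω ∂mixture ρ P, (P i).rnDeriv (mixture ρ P) ω ≤ ((ρ i)⁻¹ : ℝ≥0) := by
    refine ae_le_of_forall_setLIntegral_le_of_sigmaFinite ((P i).measurable_rnDeriv _) ?_
    intro s _ _
    refine (Measure.setLIntegral_rnDeriv_le s).trans ?_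
    rw [setLIntegral_const]
    have h1 : (ρ i : ℝ≥0∞) * P i s ≤ mixture ρ P s := smul_le_mixture ρ P i s
    have h2 : ((ρ i)⁻¹ : ℝ≥0) * (ρ i * P i s) = P i s := by
      rw [← mul_assoc, ← ENNReal.coe_mul, inv_mul_cancel₀ hi, ENNReal.coe_one, one_mul]
    calc P i s = ((ρ i)⁻¹ : ℝ≥0) * (ρ i * P i s) := h2.symm
      _ ≤ _ := by gcongr
  have hcont : ContinuousOn (fun x : ℝ => x * Real.log x) (Set.Icc 0 ((ρ i)⁻¹ : ℝ≥0)) :=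
    Real.continuous_mul_log.continuousOn
  obtain ⟨C, hC⟩ := isCompact_Icc.exists_bound_of_continuousOn hcont
  refine Integrable.of_bound (C := C) ?_ ?_
  · exact (Real.continuous_mul_log.measurable.comp
      ((P i).measurable_rnDeriv _).ennreal_toReal).aestronglyMeasurable
  · filter_upwards [hle] with ω hω
    exact hC _ ⟨ENNReal.toReal_nonneg, ENNReal.toReal_mono ENNReal.coe_ne_top hω⟩

/-- Among all reference measures, the mixture has the least mean relative entropy. -/
lemma sum_klDiv_mixture_le {ρ : ι → ℝ≥0} (hρ : ∑ i, ρ i = 1) (P : ι → Measure Ω)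
    [∀ i, IsProbabilityMeasure (P i)] (ν : Measure Ω) [IsProbabilityMeasure ν]
    (h : ∀ i, klDiv (P i) ν ≠ ∞) :
    ∑ i, ρ i * (klDiv (P i) (mixture ρ P)).toReal ≤ ∑ i, ρ i * (klDiv (P i) ν).toReal := by
  have := isProbabilityMeasure_mixture hρ P
  have hmν : mixture ρ P ≪ ν := mixture_absolutelyContinuous fun i => (klDiv_ne_top_iff.1 (h i)).1
  -- Chain rule for densities, with logarithms taken where all factors are positive and finite.
  have hllr : ∀ i, ρ i ≠ 0 → llr (mixture ρ P) ν =ᵐ[P i]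
      fun ω => llr (P i) ν ω - llr (P i) (mixture ρ P) ω := by
    intro i hi
    have hi1 := (klDiv_ne_top_iff.1 (h i)).1
    have hi2 := absolutelyContinuous_mixture P hi
    filter_upwards [hi1 (Measure.rnDeriv_mul_rnDeriv (κ := ν) hi2), Measure.rnDeriv_pos hi2,
      hi2 (Measure.rnDeriv_pos hmν), hi2 ((P i).rnDeriv_lt_top (mixture ρ P)),
      hi1 ((mixture ρ P).rnDeriv_lt_top ν)] with ω h1 h2 h3 h4 h5
    simp only [llr, ← h1, Pi.mul_apply, ENNReal.toReal_mul]
    rw [Real.log_mul (ENNReal.toReal_pos h2.ne' h4.ne).ne' (ENNReal.toReal_pos h3.ne' h5.ne).ne']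
    ring
  have hint : ∀ i, ρ i ≠ 0 → Integrable (llr (mixture ρ P) ν) (P i) := fun i hi =>
    (((klDiv_ne_top_iff.1 (h i)).2).sub
      (klDiv_ne_top_iff.1 (klDiv_mixture_ne_top hρ P hi)).2).congr (hllr i hi).symm
  -- The difference of the two averages is the relative entropy of the mixture from `ν`, which is
  -- nonnegative.
  obtain ⟨hI, hS⟩ := integral_mixture hint
  have h0 := integral_llr_add_sub_measure_univ_nonneg hmν hI
  simp only [probReal_univ, hS] at h0
  have h1 : ∀ i, (ρ i : ℝ) * ∫ ω, llr (mixture ρ P) ν ω ∂P i =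
      ρ i * (klDiv (P i) ν).toReal - ρ i * (klDiv (P i) (mixture ρ P)).toReal := by
    intro i
    by_cases hi : ρ i = 0
    · simp [hi]
    have ha := klDiv_ne_top_iff.1 (h i)
    have hb := klDiv_ne_top_iff.1 (klDiv_mixture_ne_top hρ P hi)
    rw [integral_congr_ae (hllr i hi), integral_sub ha.2 hb.2, toReal_klDiv ha.1 ha.2,
      toReal_klDiv hb.1 hb.2]
    simp only [probReal_univ]
    ring
  simp only [h1, Finset.sum_sub_distrib] at h0
  linarith

/-- The mean squared deviation between the expectations of bounded random variables under the
components and under the mixture is controlled by the mean relative entropy to any reference. -/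
lemma sum_sq_integral_mixture_le {ρ : ι → ℝ≥0} (hρ : ∑ i, ρ i = 1) (P : ι → Measure Ω)
    [∀ i, IsProbabilityMeasure (P i)] (ν : Measure Ω) [IsProbabilityMeasure ν]
    (h : ∀ i, klDiv (P i) ν ≠ ∞) {X : ι → Ω → ℝ} {a b : ℝ} (hab : a < b)
    (hm : ∀ i, Measurable (X i)) (hb : ∀ i, ∀ᵐ ω ∂mixture ρ P, X i ω ∈ Set.Icc a b) :
    ∑ i, ρ i * (∫ ω, X i ω ∂mixture ρ P - ∫ ω, X i ω ∂P i) ^ 2 ≤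
      (b - a) ^ 2 / 2 * ∑ i, ρ i * (klDiv (P i) ν).toReal := by
  have := isProbabilityMeasure_mixture hρ P
  refine le_trans ?_ (mul_le_mul_of_nonneg_left (sum_klDiv_mixture_le hρ P ν h) (by positivity))
  rw [Finset.mul_sum]
  refine Finset.sum_le_sum fun i _ => ?_
  by_cases hi : ρ i = 0
  · simp [hi]
  rw [mul_left_comm]
  exact mul_le_mul_of_nonneg_left (sq_integral_sub_integral_le_klDiv
    (klDiv_mixture_ne_top hρ P hi) hab (hm i).aemeasurable (hb i)) (NNReal.coe_nonneg _)

end KL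

/-! ### Finite-dimensional tools: trace bound, linear extension, minimax -/

section FiniteDimensional

/-- The trace of a matrix of rank at most `dim E` is at most `√(dim E)` times its Frobenius norm,
here for the matrix `√(ρ i ρ j) ℓ i (w j)`. -/
lemma sq_sum_apply_le {ι E : Type*} [Fintype ι] [AddCommGroup E] [Module ℝ E]
    [FiniteDimensional ℝ E] (ρ : ι → ℝ≥0) (w : ι → E) (ℓ : ι → E →ₗ[ℝ] ℝ) :
    (∑ i, ρ i * ℓ i (w i)) ^ 2 ≤
      Module.finrank ℝ E * ∑ i, ∑ j, ρ i * (ρ j * (ℓ i (w j)) ^ 2) := by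
  classical
  let r : ι → ℝ := fun i => √(ρ i)
  have hr : ∀ i, r i * r i = ρ i := fun i => Real.mul_self_sqrt (NNReal.coe_nonneg _)
  let B : E →ₗ[ℝ] EuclideanSpace ℝ ι :=
    (WithLp.linearEquiv 2 ℝ (ι → ℝ)).symm.toLinearMap ∘ₗ LinearMap.pi fun i => r i • ℓ i
  -- All columns `b j` of the matrix lie in the range of `B`, of dimension at most that of `E`.
  -- Expanding them in an orthonormal basis there writes the trace as an inner product over pairs
  -- (index, basis vector), ready for Cauchy–Schwarz.
  let u := stdOrthonormalBasis ℝ (LinearMap.range B)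
  let b : ι → LinearMap.range B := fun j => ⟨r j • B (w j), Submodule.smul_mem _ _ ⟨w j, rfl⟩⟩
  have hb : ∀ i j, (b j : EuclideanSpace ℝ ι) i = r j * (r i * ℓ i (w j)) := fun i j => rfl
  have hexp : ∀ i, (b i : EuclideanSpace ℝ ι) i =
      ∑ k, inner ℝ (u k) (b i) * (u k : EuclideanSpace ℝ ι) i := by
    intro i
    conv_lhs => rw [← u.sum_repr' (b i)]
    simp [Finset.sum_apply]
  have htr : ∑ i, ρ i * ℓ i (w i) =
      ∑ p : ι × Fin _, inner ℝ (u p.2) (b p.1) * (u p.2 : EuclideanSpace ℝ ι) p.1 := by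
    rw [Fintype.sum_prod_type]
    refine Finset.sum_congr rfl fun i _ => ?_
    rw [← hexp i, hb, ← hr i]
    ring
  rw [htr]
  refine (Finset.sum_mul_sq_le_sq_mul_sq _ _ _).trans ?_
  -- By Parseval the first factor is the squared Frobenius norm; the second, `h2`, counts the basis
  -- vectors.
  have h1 : ∑ p : ι × Fin (Module.finrank ℝ (LinearMap.range B)),
      (inner ℝ (u p.2) (b p.1)) ^ 2 = ∑ i, ∑ j, ρ i * (ρ j * (ℓ i (w j)) ^ 2) := by
    rw [Fintype.sum_prod_type, Finset.sum_comm (f := fun i j => (ρ i : ℝ) * (ρ j * (ℓ i (w j)) ^ 2))]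
    refine Finset.sum_congr rfl fun j _ => ?_
    have h2 := u.sum_sq_norm_inner_right (b j)
    simp only [Real.norm_eq_abs, sq_abs] at h2
    rw [h2, ← Submodule.norm_coe, EuclideanSpace.real_norm_sq_eq]
    refine Finset.sum_congr rfl fun i _ => ?_
    rw [hb, ← hr i, ← hr j]
    ring
  have h2 : ∑ p : ι × Fin (Module.finrank ℝ (LinearMap.range B)),
      ((u p.2 : EuclideanSpace ℝ ι) p.1) ^ 2 = Module.finrank ℝ (LinearMap.range B) := by
    rw [Fintype.sum_prod_type_right]
    have h3 : ∀ k, ∑ i, ((u k : EuclideanSpace ℝ ι) i) ^ 2 = 1 := by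
      intro k
      rw [← EuclideanSpace.real_norm_sq_eq, Submodule.norm_coe, u.norm_eq_one]
      norm_num
    simp [h3]
  rw [h1, h2, mul_comm]
  refine mul_le_mul_of_nonneg_right ?_ ?_
  · exact_mod_cast LinearMap.finrank_range_le B
  · exact Finset.sum_nonneg fun i _ => Finset.sum_nonneg fun j _ => by positivity

/-- Integration, as a linear functional of the parameter of a linear family of functions, not all
of which need be integrable. -/
lemma exists_linearMap_eq_integral {E Ω : Type*} [AddCommGroup E] [Module ℝ E]
    [MeasurableSpace Ω] (μ : Measure Ω) (T : E →ₗ[ℝ] (Ω → ℝ)) :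
    ∃ ℓ : E →ₗ[ℝ] ℝ, ∀ x, Integrable (T x) μ → ℓ x = ∫ ω, T x ω ∂μ := by
  let W : Submodule ℝ E :=
    { carrier := {x | Integrable (T x) μ}
      add_mem' := fun {x y} hx hy => by
        simp only [Set.mem_ofPred_eq, map_add] at *
        exact hx.add hy
      zero_mem' := by
        simp only [Set.mem_ofPred_eq, map_zero]
        exact integrable_zero _ _ _
      smul_mem' := fun c x hx => by
        simp only [Set.mem_ofPred_eq, map_smul] at *
        exact hx.smul c }
  let f : W →ₗ[ℝ] ℝ :=
    { toFun := fun x => ∫ ω, T x ω ∂μ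
      map_add' := fun x y => by
        simp only [Submodule.coe_add, map_add, Pi.add_apply]
        exact integral_add x.2 y.2
      map_smul' := fun c x => by
        simp only [Submodule.coe_smul, map_smul, Pi.smul_apply, RingHom.id_apply]
        exact integral_smul c _ }
  -- The integral is linear only on the subspace of integrable parameters; any algebraic extension
  -- to `E` serves.
  obtain ⟨ℓ, hℓ⟩ := f.exists_extend
  exact ⟨ℓ, fun x hx => LinearMap.congr_fun hℓ ⟨x, hx⟩⟩

/-- A minimax theorem for a player with finitely many actions against an arbitrary opponent. -/
lemma exists_stdSimplex_forall_sum_le {κ : Type*} [Fintype κ] [Nonempty κ] {T : Set (κ → ℝ)}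
    {C : ℝ} (h : ∀ v ∈ convexHull ℝ T, ∃ k, v k ≤ C) :
    ∃ q ∈ stdSimplex ℝ κ, ∀ v ∈ T, ∑ k, q k * v k ≤ C := by
  classical
  obtain rfl | ⟨v₀, hv₀⟩ := T.eq_empty_or_nonempty
  · obtain ⟨k⟩ := ‹Nonempty κ›
    exact ⟨_, single_mem_stdSimplex ℝ k, by simp⟩
  let s : Set (κ → ℝ) := Set.univ.pi fun _ => Set.Ioi C
  have hs : ∀ a, a ∈ s ↔ ∀ k, C < a k := by simp [s]
  have hdisj : Disjoint s (convexHull ℝ T) := by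
    rw [Set.disjoint_left]
    intro a ha hT
    obtain ⟨k, hk⟩ := h a hT
    exact absurd ((hs a).1 ha k) (not_lt.2 hk)
  -- Separate the hull from the open orthant of vectors with all entries above `C`. Minus the
  -- coefficients of the functional, once normalized, form the mixed strategy.
  obtain ⟨f, u, hfs, hfT⟩ := geometric_hahn_banach_open
    (convex_pi fun _ _ => convex_Ioi C) (isOpen_set_pi Set.finite_univ fun _ _ => isOpen_Ioi)
    (convex_convexHull ℝ T) hdisj
  let g : κ → ℝ := fun k => -f (Pi.single k 1)
  have hf : ∀ a : κ → ℝ, f a = -∑ k, g k * a k := by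
    intro a
    have ha : a = ∑ k, a k • (Pi.single k 1 : κ → ℝ) := by
      ext j
      simp [Finset.sum_apply, Pi.single_apply]
    conv_lhs => rw [ha]
    simp only [map_sum, map_smul, smul_eq_mul, g, ← Finset.sum_neg_distrib]
    exact Finset.sum_congr rfl fun k _ => by ring
  have hconst : ∀ c : ℝ, f (fun _ => c) = -((∑ k, g k) * c) := fun c => by
    rw [hf, Finset.sum_mul]
  have hg : ∀ k, 0 ≤ g k := by
    intro k
    by_contra hk
    push Not at hk
    -- Moving along coordinate `k` stays in the orthant, so a negative `g k` would make the
    -- functional unbounded there; the `t` used in `h1` below makes the left side equal `u`.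
    have ha : ∀ t : ℝ, 0 ≤ t → -((∑ k, g k) * (C + 1)) - t * g k < u := by
      intro t ht
      have h1 := hfs ((fun _ => C + 1) + t • Pi.single k 1) ((hs _).2 fun j => by
        have : (0 : ℝ) ≤ (Pi.single k 1 : κ → ℝ) j := by
          rw [Pi.single_apply]; split_ifs <;> norm_num
        simp only [Pi.add_apply, Pi.smul_apply, smul_eq_mul]
        nlinarith)
      rw [map_add, map_smul, hconst] at h1
      simp only [smul_eq_mul, g] at h1 ⊢
      linarith
    have h0 := ha 0 le_rfl
    have h1 := ha ((u - -((∑ k, g k) * (C + 1))) / (-g k))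
      (div_nonneg (by linarith) (by linarith))
    have h2 : (u - -((∑ k, g k) * (C + 1))) / (-g k) * g k = -(u - -((∑ k, g k) * (C + 1))) := by
      field_simp [hk.ne]
    linarith
  have hle : ∀ v ∈ T, ∀ ε > 0, ∑ k, g k * v k < (∑ k, g k) * (C + ε) := by
    intro v hv ε hε
    have h1 := hfs (fun _ => C + ε) ((hs _).2 fun _ => by linarith)
    have h2 := hfT v (subset_convexHull ℝ T hv)
    rw [hconst] at h1
    rw [hf] at h2
    linarith
  have hG : 0 < ∑ k, g k := by
    refine lt_of_le_of_ne (Finset.sum_nonneg fun k _ => hg k) fun h0 => ?_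
    have h1 : ∀ k, g k = 0 := fun k =>
      (Finset.sum_eq_zero_iff_of_nonneg fun k _ => hg k).1 h0.symm k (Finset.mem_univ k)
    have h2 := hle v₀ hv₀ 1 one_pos
    simp [h1] at h2
  refine ⟨fun k => g k / ∑ k, g k, ⟨fun k => div_nonneg (hg k) hG.le, ?_⟩, fun v hv => ?_⟩
  · rw [← Finset.sum_div, div_self hG.ne']
  · have h1 : ∑ k, g k / (∑ k, g k) * v k = (∑ k, g k * v k) / ∑ k, g k := by
      rw [Finset.sum_div]
      exact Finset.sum_congr rfl fun k _ => by ring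
    rw [h1, div_le_iff₀ hG]
    refine le_of_forall_pos_lt_add fun ε hε => ?_
    have h2 := hle v hv (ε / ∑ k, g k) (div_pos hε hG)
    rw [mul_add, mul_div_cancel₀ _ hG.ne'] at h2
    linarith

end FiniteDimensional

/-! ### Value functions evaluated along a trajectory -/

section ValueAt

variable {S A : Type*}

/-- The value `V_{h+i}(s_{h+i})` along a trajectory that starts at step `h`; it is zero after the
end of the trajectory. -/
noncomputable def valueAt (V : ℕ → S → ℝ) (h : ℕ) {n : ℕ} (i : ℕ) (o : Traj S A n) : ℝ :=
  if hi : i < n then V (h + i) (o ⟨i, hi⟩).1 else 0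

lemma valueAt_cons (V : ℕ → S → ℝ) (h : ℕ) {n : ℕ} (i : ℕ) (x : S × A × ℝ) (o : Traj S A n) :
    valueAt V h (i + 1) (Fin.cons x o : Traj S A (n + 1)) = valueAt V (h + 1) i o := by
  unfold valueAt
  by_cases hi : i < n
  · rw [dif_pos (Nat.succ_lt_succ hi), dif_pos hi, show h + (i + 1) = h + 1 + i by ring]
    rfl
  · rw [dif_neg (by omega), dif_neg hi]

lemma norm_valueAt_le {V : ℕ → S → ℝ} {C : ℝ} (hV : ∀ h s, ‖V h s‖ ≤ C) (hC : 0 ≤ C) (h : ℕ)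
    {n : ℕ} (i : ℕ) (o : Traj S A n) : ‖valueAt V h i o‖ ≤ C := by
  unfold valueAt
  split_ifs
  · exact hV _ _
  · simpa using hC

lemma valueAt_mem {V : ℕ → S → ℝ} (hV : ∀ h s, V h s ∈ Set.Icc (0 : ℝ) 1) (h i : ℕ)
    {n : ℕ} (o : Traj S A n) : valueAt V h i o ∈ Set.Icc (0 : ℝ) 1 := by
  unfold valueAt
  split_ifs
  · exact hV _ _
  · simp

lemma valueAt_fin (V : ℕ → S → ℝ) {n : ℕ} (i : Fin n) (o : Traj S A n) :
    valueAt V 0 i o = V i (o i).1 := by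
  simp [valueAt]

end ValueAt

/-! ### Trajectory laws: recursion, almost sure properties, Bellman identity -/

section Trajectories

variable {S A : Type*} [MeasurableSpace S] [MeasurableSpace A]

instance (M : MDP S A) (π : Policy S A) (h : ℕ) : IsMarkovKernel (M.next π h) := by
  have := M.markov h
  unfold MDP.next
  infer_instance

lemma measurable_cons_step (M : MDP S A) (π : Policy S A) (n h : ℕ) :
    Measurable (fun x : S × Traj S A n =>
      (Fin.cons (x.1, π.act h x.1, M.R h (x.1, π.act h x.1)) x.2 : Traj S A (n + 1))) := by
  have hact := π.measurable_act h
  have hR := M.measurable_R h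
  refine measurable_pi_iff.2 fun i => ?_
  refine Fin.cases ?_ (fun j => ?_) i
  · simp only [Fin.cons_zero]
    fun_prop
  · simp only [Fin.cons_succ]
    fun_prop

instance (M : MDP S A) (π : Policy S A) (n h : ℕ) : IsMarkovKernel (M.trajKernel π n h) := by
  induction n generalizing h with
  | zero =>
    unfold MDP.trajKernel
    infer_instance
  | succ n ih =>
    unfold MDP.trajKernel
    have := ih (h + 1)
    exact Kernel.IsMarkovKernel.map _ (measurable_cons_step M π n h)

lemma trajKernel_succ_apply (M : MDP S A) (π : Policy S A) (n h : ℕ) (s : S) :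
    M.trajKernel π (n + 1) h s =
      ((M.trajKernel π n (h + 1) ∘ₖ M.next π h) s).map
        (fun o => Fin.cons (s, π.act h s, M.R h (s, π.act h s)) o) := by
  rw [MDP.trajKernel, Kernel.map_apply _ (measurable_cons_step M π n h), Kernel.prod_apply,
    Kernel.id_apply, Measure.dirac_prod,
    Measure.map_map (measurable_cons_step M π n h) measurable_prodMk_left]
  rfl

lemma measurable_cons_const (n : ℕ) (x : S × A × ℝ) :
    Measurable (fun o : Traj S A n => (Fin.cons x o : Traj S A (n + 1))) := by
  refine measurable_pi_iff.2 fun i => ?_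
  refine Fin.cases ?_ (fun j => ?_) i
  · simp only [Fin.cons_zero]
    fun_prop
  · simp only [Fin.cons_succ]
    fun_prop

lemma integral_trajKernel_succ (M : MDP S A) (π : Policy S A) (n h : ℕ) (s : S)
    {F : Traj S A (n + 1) → ℝ} (hF : Measurable F) {C : ℝ} (hC : ∀ o, ‖F o‖ ≤ C) :
    ∫ o, F o ∂(M.trajKernel π (n + 1) h s) =
      ∫ s', ∫ o, F (Fin.cons (s, π.act h s, M.R h (s, π.act h s)) o)
        ∂(M.trajKernel π n (h + 1) s') ∂(M.next π h s) := by
  rw [trajKernel_succ_apply, integral_map (measurable_cons_const n _).aemeasurable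
    hF.aestronglyMeasurable, Kernel.integral_comp]
  exact Integrable.of_bound (hF.comp (measurable_cons_const n _)).aestronglyMeasurable C
    (Filter.Eventually.of_forall fun o => hC _)

/-- Measurable sets `B h` stand in for the graphs of the policy and reward, which need not be
measurable when `S × A` is an arbitrary measurable space. -/
lemma ae_trajKernel (M : MDP S A) (π : Policy S A) {B : ℕ → Set (S × A × ℝ)}
    (hB : ∀ h, MeasurableSet (B h))
    (hmem : ∀ h s, (s, π.act h s, M.R h (s, π.act h s)) ∈ B h) (n h : ℕ) (s : S) :
    ∀ᵐ o ∂(M.trajKernel π n h s), ∀ i : Fin n, o i ∈ B (h + i) := by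
  induction n generalizing h s with
  | zero => exact Filter.Eventually.of_forall fun o i => i.elim0
  | succ n ih =>
    have hmeas : ∀ m k, MeasurableSet {o : Traj S A m | ∀ i : Fin m, o i ∈ B (k + i)} := by
      intro m k
      simp only [Set.ofPred_forall]
      exact MeasurableSet.iInter fun i => measurable_pi_apply i (hB _)
    rw [trajKernel_succ_apply, ae_map_iff (measurable_cons_const n _).aemeasurable (hmeas _ _)]
    have hcomp : ∀ᵐ o ∂((M.trajKernel π n (h + 1) ∘ₖ M.next π h) s),
        ∀ i : Fin n, o i ∈ B (h + 1 + i) :=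
      Kernel.ae_comp_of_ae_ae (hmeas _ _) (Filter.Eventually.of_forall fun s' => ih (h + 1) s')
    filter_upwards [hcomp] with o ho i
    refine Fin.cases ?_ (fun j => ?_) i
    · simpa using hmem h s
    · have := ho j
      rw [Fin.cons_succ, Fin.val_succ, show h + (j + 1) = h + 1 + j by ring]
      exact this

lemma ae_trajKernel_zero (M : MDP S A) (π : Policy S A) {B : Set S} (hB : MeasurableSet B)
    (n h : ℕ) {s : S} (hs : s ∈ B) :
    ∀ᵐ o ∂(M.trajKernel π n h s), ∀ i : Fin n, (i : ℕ) = 0 → (o i).1 ∈ B := by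
  cases n with
  | zero => exact Filter.Eventually.of_forall fun o i => i.elim0
  | succ n =>
    have hmeas : MeasurableSet {o : Traj S A (n + 1) | (o 0).1 ∈ B} :=
      (measurable_fst.comp (measurable_pi_apply 0)) hB
    have h0 : ∀ᵐ o ∂(M.trajKernel π (n + 1) h s), (o 0).1 ∈ B := by
      rw [trajKernel_succ_apply, ae_map_iff (measurable_cons_const n _).aemeasurable hmeas]
      exact Filter.Eventually.of_forall fun o => by simpa using hs
    filter_upwards [h0] with o ho i hi
    obtain rfl : i = 0 := Fin.ext hi
    exact ho

lemma measurable_valueAt {V : ℕ → S → ℝ} (hV : ∀ h, Measurable (V h)) (h : ℕ) {n : ℕ} (i : ℕ) :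
    Measurable (valueAt V h i : Traj S A n → ℝ) := by
  unfold valueAt
  split_ifs
  · have := hV (h + i)
    fun_prop
  · exact measurable_const

lemma integral_valueAt_zero (M : MDP S A) (π : Policy S A) {V : ℕ → S → ℝ}
    (hV : ∀ h, Measurable (V h)) {C : ℝ} (hC : ∀ h s, ‖V h s‖ ≤ C) (n h : ℕ) (s : S)
    (hend : ∀ s, V (h + n) s = 0) :
    ∫ o, valueAt V h 0 o ∂(M.trajKernel π n h s) = V h s := by
  cases n with
  | zero => simpa [valueAt] using (hend s).symm
  | succ n =>
    rw [integral_trajKernel_succ M π n h s (measurable_valueAt hV h 0)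
      (norm_valueAt_le hC ((norm_nonneg _).trans (hC h s)) h 0)]
    simp [valueAt]

/-- The next value is, in expectation, its conditional expectation given the state and action. -/
lemma integral_next_sub_valueAt (M : MDP S A) (π : Policy S A) {V : ℕ → S → ℝ}
    (hV : ∀ h, Measurable (V h)) {C : ℝ} (hC : ∀ h s, ‖V h s‖ ≤ C) (n h : ℕ) (s : S)
    (hend : ∀ s, V (h + n) s = 0) (i : Fin n) :
    ∫ o, (∫ s', V (h + i + 1) s' ∂(M.P (h + i) ((o i).1, (o i).2.1))) - valueAt V h (i + 1) o
      ∂(M.trajKernel π n h s) = 0 := by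
  have hg : ∀ k, Measurable fun x : S × A => ∫ s', V (k + 1) s' ∂(M.P k x) := fun k => by
    have := M.markov k
    exact ((hV (k + 1)).stronglyMeasurable.integral_kernel (κ := M.P k)).measurable
  have hgC : ∀ k x, ‖∫ s', V (k + 1) s' ∂(M.P k x)‖ ≤ C := fun k x => by
    have := M.markov k
    exact (norm_integral_le_of_norm_le_const (μ := M.P k x)
      (Filter.Eventually.of_forall fun s' => hC (k + 1) s')).trans (by simp)
  have hC0 : 0 ≤ C := (norm_nonneg _).trans (hC h s)
  induction n generalizing h s with
  | zero => exact i.elim0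
  | succ n ih =>
    have hmeas : Measurable fun o : Traj S A (n + 1) =>
        (∫ s', V (h + i + 1) s' ∂(M.P (h + i) ((o i).1, (o i).2.1))) - valueAt V h (i + 1) o := by
      refine Measurable.sub ?_ (measurable_valueAt hV h _)
      exact (hg (h + i)).comp (f := fun o : Traj S A (n + 1) => ((o i).1, (o i).2.1)) (by fun_prop)
    rw [integral_trajKernel_succ M π n h s hmeas (C := C + C) fun o =>
      (norm_sub_le _ _).trans (add_le_add (hgC _ _) (norm_valueAt_le hC hC0 h _ o))]
    have hend' : ∀ s, V (h + 1 + n) s = 0 := by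
      rw [show h + 1 + n = h + (n + 1) by ring]
      exact hend
    refine Fin.cases ?_ (fun j => ?_) i
    -- Given the next state `s'`, the value read at the start of the tail is `V (h + 1) s'`; for an
    -- empty tail both vanish by `hend'`.
    · simp only [Fin.cons_zero, Fin.val_zero, Nat.add_zero, valueAt_cons]
      have hin : ∀ s', ∫ o, (∫ s', V (h + 1) s' ∂(M.P h (s, π.act h s))) - valueAt V (h + 1) 0 o
          ∂(M.trajKernel π n (h + 1) s') =
          (∫ s', V (h + 1) s' ∂(M.P h (s, π.act h s))) - V (h + 1) s' := by
        intro s'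
        rw [integral_sub (integrable_const _), integral_valueAt_zero M π hV hC n (h + 1) s' hend']
        · simp
        · exact Integrable.of_bound (measurable_valueAt hV _ _).aestronglyMeasurable C
            (Filter.Eventually.of_forall fun o => norm_valueAt_le hC hC0 _ _ o)
      simp only [hin]
      rw [integral_sub (integrable_const _)]
      · have := M.markov h
        simp [MDP.next, Kernel.comap_apply]
      · exact Integrable.of_bound (hV _).aestronglyMeasurable C
          (Filter.Eventually.of_forall fun o => hC _ _)
    · simp only [Fin.cons_succ, Fin.val_succ, valueAt_cons]
      have := fun s' => ih (h + 1) s' hend' j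
      rw [show h + (j + 1) = h + 1 + j by ring]
      simp only [this, integral_zero]

end Trajectories

/-! ### Bellman consistency and performance differences -/

section Consistency

variable {S A : Type*} [MeasurableSpace S] [MeasurableSpace A] {H : ℕ}

/-- `Q` and `V` are the linear optimal value functions with parameter `f`, for which the policy `π`
is greedy. -/
structure IsOptimalPair (H : ℕ) {d : ℕ} (φ : ℕ → S → A → EuclideanSpace ℝ (Fin d))
    (ψ : ℕ → S → EuclideanSpace ℝ (Fin d))
    (f : EuclideanSpace ℝ (Fin d) × EuclideanSpace ℝ (Fin d)) (π : Policy S A)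
    (Q : ℕ → S × A → ℝ) (V : ℕ → S → ℝ) : Prop where
  measurable_Q : ∀ h, Measurable (Q h)
  measurable_V : ∀ h, Measurable (V h)
  Q_mem : ∀ h x, Q h x ∈ Set.Icc (0 : ℝ) 1
  V_mem : ∀ h s, V h s ∈ Set.Icc (0 : ℝ) 1
  V_horizon : ∀ s, V H s = 0
  Q_le : ∀ h < H, ∀ s a, Q h (s, a) ≤ V h s
  Q_act : ∀ h < H, ∀ s, Q h (s, π.act h s) = V h s
  Q_eq : ∀ h < H, ∀ s a, Q h (s, a) = inner ℝ (φ h s a) f.1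
  V_eq : ∀ h < H, ∀ s, V h s = inner ℝ (ψ h s) f.2

/-- The almost sure properties of the trajectories of the policy `π` which every mixture of MDPs
shares. -/
structure IsTrajLike (s₁ : S) (π : Policy S A) (μ : Measure (Traj S A H)) : Prop where
  isProbabilityMeasure : IsProbabilityMeasure μ
  ae_step : ∀ B : ℕ → Set (S × A × ℝ), (∀ h, MeasurableSet (B h)) →
    (∀ h s, ∀ r ∈ Set.Icc (0 : ℝ) 1, (s, π.act h s, r) ∈ B h) → ∀ᵐ o ∂μ, ∀ i : Fin H, o i ∈ B i
  ae_init : ∀ B : Set S, MeasurableSet B → s₁ ∈ B → ∀ᵐ o ∂μ, ∀ i : Fin H, (i : ℕ) = 0 → (o i).1 ∈ B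

/-- The Bellman error of `(Q, V)` at step `i` of a trajectory. -/
noncomputable def bellmanError (Q : ℕ → S × A → ℝ) (V : ℕ → S → ℝ) (i : Fin H)
    (o : Traj S A H) : ℝ :=
  Q i ((o i).1, (o i).2.1) - (o i).2.2 - valueAt V 0 (i + 1) o

/-- The law `μ` of the trajectories of `π` satisfies the Bellman equations of `(Q, V)` on average. -/
structure IsConsistent (s₁ : S) (Q : ℕ → S × A → ℝ) (V : ℕ → S → ℝ) (π : Policy S A)
    (μ : Measure (Traj S A H)) : Prop extends IsTrajLike s₁ π μ where
  integral_bellmanError : ∀ i : Fin H, ∫ o, bellmanError Q V i o ∂μ = 0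

variable {s₁ : S} {π : Policy S A} {μ : Measure (Traj S A H)}

lemma IsTrajLike.ae_reward_mem (hμ : IsTrajLike s₁ π μ) :
    ∀ᵐ o ∂μ, ∀ i, (o i).2.2 ∈ Set.Icc (0 : ℝ) 1 :=
  hμ.ae_step (fun _ => {x | x.2.2 ∈ Set.Icc (0 : ℝ) 1})
    (fun _ => (measurable_snd.comp measurable_snd) measurableSet_Icc) fun _ _ _ hr => hr

lemma measurable_bellmanError {Q : ℕ → S × A → ℝ} {V : ℕ → S → ℝ} (hQ : ∀ h, Measurable (Q h))
    (hV : ∀ h, Measurable (V h)) (i : Fin H) :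
    Measurable (bellmanError Q V i : Traj S A H → ℝ) := by
  unfold bellmanError
  have := hQ i
  have := measurable_valueAt (A := A) (n := H) hV 0 (i + 1)
  fun_prop

lemma IsTrajLike.ae_bellmanError_mem (hμ : IsTrajLike s₁ π μ) {Q : ℕ → S × A → ℝ}
    {V : ℕ → S → ℝ} (hQ : ∀ h x, Q h x ∈ Set.Icc (0 : ℝ) 1)
    (hV : ∀ h s, V h s ∈ Set.Icc (0 : ℝ) 1) (i : Fin H) :
    ∀ᵐ o ∂μ, bellmanError Q V i o ∈ Set.Icc (-2 : ℝ) 1 := by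
  filter_upwards [hμ.ae_reward_mem] with o ho
  have h1 := ho i
  have h2 := hQ i ((o i).1, (o i).2.1)
  have h3 := valueAt_mem hV 0 (i + 1) o
  simp only [bellmanError, Set.mem_Icc] at *
  constructor <;> linarith [h1.1, h1.2, h2.1, h2.2, h3.1, h3.2]

lemma IsTrajLike.integrable_reward (hμ : IsTrajLike s₁ π μ) (i : Fin H) :
    Integrable (fun o => (o i).2.2) μ := by
  have := hμ.isProbabilityMeasure
  refine Integrable.of_mem_Icc 0 1
    (Measurable.aemeasurable (f := fun o : Traj S A H => (o i).2.2) (by fun_prop)) ?_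
  filter_upwards [hμ.ae_reward_mem] with o ho using ho i

lemma IsTrajLike.integrable_valueAt (hμ : IsTrajLike s₁ π μ) {V : ℕ → S → ℝ}
    (hVm : ∀ h, Measurable (V h)) (hV : ∀ h s, V h s ∈ Set.Icc (0 : ℝ) 1) (i : ℕ) :
    Integrable (fun o => valueAt V 0 i o) μ := by
  have := hμ.isProbabilityMeasure
  exact Integrable.of_mem_Icc 0 1 (measurable_valueAt hVm 0 i).aemeasurable
    (Filter.Eventually.of_forall fun o => valueAt_mem hV 0 i o)

lemma IsTrajLike.integrable_bellmanError (hμ : IsTrajLike s₁ π μ) {Q : ℕ → S × A → ℝ}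
    {V : ℕ → S → ℝ} (hQm : ∀ h, Measurable (Q h)) (hVm : ∀ h, Measurable (V h))
    (hQ : ∀ h x, Q h x ∈ Set.Icc (0 : ℝ) 1)
    (hV : ∀ h s, V h s ∈ Set.Icc (0 : ℝ) 1) (i : Fin H) : Integrable (bellmanError Q V i) μ := by
  have := hμ.isProbabilityMeasure
  exact Integrable.of_mem_Icc (-2) 1 (measurable_bellmanError hQm hVm i).aemeasurable
    (hμ.ae_bellmanError_mem hQ hV i)

lemma IsTrajLike.value_mem {Pol : Type*} {M : Pol → Measure (Traj S A H)} {p : Pol}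
    (hμ : IsTrajLike s₁ π (M p)) : value totalReward M p ∈ Set.Icc (0 : ℝ) H := by
  have := hμ.isProbabilityMeasure
  have hv : value totalReward M p = ∑ i, ∫ o, (o i).2.2 ∂M p :=
    integral_finsetSum _ fun i _ => hμ.integrable_reward i
  have h0 : ∀ i, ∫ o, (o i).2.2 ∂M p ∈ Set.Icc (0 : ℝ) 1 := fun i => by
    constructor
    · refine integral_nonneg_of_ae ?_
      filter_upwards [hμ.ae_reward_mem] with o ho using (ho i).1
    · have h1 : ∫ o, (o i).2.2 ∂M p ≤ ∫ _, (1 : ℝ) ∂M p := by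
        refine integral_mono_ae (hμ.integrable_reward i) (integrable_const _) ?_
        filter_upwards [hμ.ae_reward_mem] with o ho using (ho i).2
      simpa using h1
  rw [hv]
  refine ⟨Finset.sum_nonneg fun i _ => (h0 i).1, ?_⟩
  exact (Finset.sum_le_sum fun i _ => (h0 i).2).trans (by simp)

/-- The initial value minus the value of a policy is a telescoping sum along the trajectory. -/
lemma IsTrajLike.sub_value_eq_sum {Pol : Type*} {M : Pol → Measure (Traj S A H)} {p : Pol}
    (hμ : IsTrajLike s₁ π (M p)) {V : ℕ → S → ℝ} (hVm : ∀ h, Measurable (V h))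
    (hV : ∀ h s, V h s ∈ Set.Icc (0 : ℝ) 1) (hend : ∀ s, V H s = 0) :
    V 0 s₁ - value totalReward M p =
      ∑ i : Fin H, ∫ o, (valueAt V 0 i o - (o i).2.2 - valueAt V 0 (i + 1) o) ∂M p := by
  have := hμ.isProbabilityMeasure
  have hv : value totalReward M p = ∑ i, ∫ o, (o i).2.2 ∂M p :=
    integral_finsetSum _ fun i _ => hμ.integrable_reward i
  have hval := hμ.integrable_valueAt hVm hV
  have hinit : ∫ o, valueAt V 0 0 o ∂M p = V 0 s₁ := by
    have hae : ∀ᵐ o ∂M p, valueAt V 0 0 o = V 0 s₁ := by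
      filter_upwards [hμ.ae_init {s | V 0 s = V 0 s₁} (hVm 0 (measurableSet_singleton _)) rfl]
        with o ho
      unfold valueAt
      split_ifs with h0
      · exact ho ⟨0, h0⟩ rfl
      · obtain rfl : H = 0 := by omega
        exact (hend s₁).symm
    rw [integral_congr_ae hae]
    simp
  have hlast : ∫ o, valueAt V 0 H o ∂M p = 0 := by simp [valueAt]
  have hi : ∀ i : Fin H, ∫ o, (valueAt V 0 i o - (o i).2.2 - valueAt V 0 (i + 1) o) ∂M p =
      (∫ o, valueAt V 0 i o ∂M p - ∫ o, valueAt V 0 (i + 1) o ∂M p) - ∫ o, (o i).2.2 ∂M p := by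
    intro i
    have h1 : Integrable (fun o => valueAt V 0 i o - (o i).2.2) (M p) :=
      (hval _).sub (hμ.integrable_reward i)
    rw [integral_sub h1 (hval _), integral_sub (hval _) (hμ.integrable_reward i)]
    ring
  simp only [hi, Finset.sum_sub_distrib, ← hv]
  rw [← Finset.sum_sub_distrib,
    Fin.sum_univ_eq_sum_range (fun i => ∫ o, valueAt V 0 i o ∂M p - ∫ o, valueAt V 0 (i + 1) o ∂M p),
    Finset.sum_range_sub' (fun i => ∫ o, valueAt V 0 i o ∂M p), hinit, hlast]
  ring

variable {d : ℕ} {φ : ℕ → S → A → EuclideanSpace ℝ (Fin d)}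
    {ψ : ℕ → S → EuclideanSpace ℝ (Fin d)}
    {f : EuclideanSpace ℝ (Fin d) × EuclideanSpace ℝ (Fin d)}
    {Q : ℕ → S × A → ℝ} {V : ℕ → S → ℝ}

/-- The initial optimal value bounds the value of every policy in a consistent model. -/
lemma IsConsistent.value_le {Pol : Type*} {M : Pol → Measure (Traj S A H)} {p : Pol}
    {π' : Policy S A} (hμ : IsConsistent s₁ Q V π (M p)) (hQV : IsOptimalPair H φ ψ f π' Q V) :
    value totalReward M p ≤ V 0 s₁ := by
  have := hμ.isProbabilityMeasure
  have hval := hμ.integrable_valueAt hQV.measurable_V hQV.V_mem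
  have h := hμ.sub_value_eq_sum hQV.measurable_V hQV.V_mem hQV.V_horizon
  have h0 : 0 ≤ V 0 s₁ - value totalReward M p := by
    rw [h]
    refine Finset.sum_nonneg fun i _ => ?_
    -- Replace `0` by the mean Bellman error; the comparison is then the pointwise inequality `Q ≤
    -- V`.
    rw [← hμ.integral_bellmanError i]
    refine integral_mono (hμ.integrable_bellmanError hQV.measurable_Q hQV.measurable_V hQV.Q_mem
      hQV.V_mem i) (((hval _).sub (hμ.integrable_reward i)).sub (hval _)) fun o => ?_
    have := hQV.Q_le i i.2 (o i).1 (o i).2.1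
    simp only [bellmanError, valueAt_fin] at *
    linarith
  linarith

/-- The performance difference of the greedy policy is its expected total Bellman error. -/
lemma IsTrajLike.sub_value_eq_sum_bellmanError {Pol : Type*} {M : Pol → Measure (Traj S A H)}
    {p : Pol} (hμ : IsTrajLike s₁ π (M p)) (hQV : IsOptimalPair H φ ψ f π Q V) :
    V 0 s₁ - value totalReward M p = ∑ i, ∫ o, bellmanError Q V i o ∂M p := by
  rw [hμ.sub_value_eq_sum hQV.measurable_V hQV.V_mem hQV.V_horizon]
  refine Finset.sum_congr rfl fun i _ => integral_congr_ae ?_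
  have hm := hQV.measurable_Q
  have hm' := hQV.measurable_V
  -- Greediness turns each `V` of the telescoping sum into `Q` at the action played; no Bellman
  -- equation is needed.
  have hae := hμ.ae_step (fun h => {x | h < H → Q h (x.1, x.2.1) = V h x.1})
    (fun h => by
      by_cases hh : h < H
      · simp only [hh, forall_const]
        exact measurableSet_eq_fun (by fun_prop) (by fun_prop)
      · simp [hh])
    (fun h s r _ hh => hQV.Q_act h hh s)
  filter_upwards [hae] with o ho
  have := ho i i.2
  simp only [bellmanError, valueAt_fin, ← this]

/-- The laws of the trajectories of an MDP are consistent with its optimal value functions. -/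
lemma isConsistent_trajLaw (M : MDP S A) (π' : Policy S A) (hQV : IsOptimalPair H φ ψ f π' Q V)
    {σ : Policy S A} (hQ : ∀ h < H, ∀ s a, M.Q H σ h s a = Q h (s, a))
    (hV : ∀ h < H, ∀ s, M.V H σ h s = V h s) :
    IsConsistent s₁ Q V π (M.trajLaw H s₁ π) where
  isProbabilityMeasure := by unfold MDP.trajLaw; infer_instance
  ae_step B hB hmem := by
    have := ae_trajKernel M π hB (fun h s => hmem h s _ (M.R_mem h _)) H 0 s₁
    simp only [Nat.zero_add] at this
    exact this
  ae_init B hB hs := ae_trajKernel_zero M π hB H 0 hs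
  integral_bellmanError i := by
    have hC : ∀ h s, ‖V h s‖ ≤ 1 := fun h s => by
      rw [Real.norm_eq_abs, abs_le]
      constructor <;> linarith [(hQV.V_mem h s).1, (hQV.V_mem h s).2]
    have key := integral_next_sub_valueAt M π hQV.measurable_V hC H 0 s₁
      (by simpa using hQV.V_horizon) i
    refine Eq.trans (integral_congr_ae ?_) key
    have hm := M.measurable_R
    have hae := ae_trajKernel M π (B := fun h => {x | x.2.2 = M.R h (x.1, x.2.1)})
      (fun h => measurableSet_eq_fun (by fun_prop) (by fun_prop)) (fun h s => rfl) H 0 s₁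
    filter_upwards [hae] with o ho
    have h1 := ho i
    -- The hypotheses cover only steps below `H`; at `i + 1 = H` both sides are zero.
    have h2 : M.V H σ (i + 1) = V (i + 1) := by
      funext s
      rcases Nat.lt_or_ge (i + 1 : ℕ) H with hi | hi
      · exact hV _ hi s
      · have : (i + 1 : ℕ) = H := by omega
        simp [MDP.V, this, MDP.rewardToGo, hQV.V_horizon]
    have h3 := hQ i i.2 (o i).1 (o i).2.1
    simp only [Nat.zero_add] at h1 ⊢
    simp only [bellmanError, ← h3, h1, MDP.Q, h2]
    ring

end Consistency

/-! ### Mixtures of consistent models and the posterior sampling bound -/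

section PosteriorSampling

variable {S A : Type*} [MeasurableSpace S] [MeasurableSpace A] {H : ℕ} {s₁ : S}
    {d : ℕ} {φ : ℕ → S → A → EuclideanSpace ℝ (Fin d)} {ψ : ℕ → S → EuclideanSpace ℝ (Fin d)}
    {ι : Type*} [Fintype ι] {ρ : ι → ℝ≥0}

lemma IsTrajLike.mixture (hρ : ∑ i, ρ i = 1) {π : Policy S A} {P : ι → Measure (Traj S A H)}
    (hP : ∀ i, IsTrajLike s₁ π (P i)) : IsTrajLike s₁ π (mixture ρ P) where
  isProbabilityMeasure := by
    have := fun i => (hP i).isProbabilityMeasure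
    exact isProbabilityMeasure_mixture hρ P
  ae_step B hB hmem := ae_mixture fun i => (hP i).ae_step B hB hmem
  ae_init B hB hmem := ae_mixture fun i => (hP i).ae_init B hB hmem

lemma IsConsistent.mixture (hρ : ∑ i, ρ i = 1) {π π' : Policy S A}
    {f : EuclideanSpace ℝ (Fin d) × EuclideanSpace ℝ (Fin d)}
    {Q : ℕ → S × A → ℝ} {V : ℕ → S → ℝ} (hQV : IsOptimalPair H φ ψ f π' Q V)
    {P : ι → Measure (Traj S A H)} (hP : ∀ i, IsConsistent s₁ Q V π (P i)) :
    IsConsistent s₁ Q V π (mixture ρ P) where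
  toIsTrajLike := IsTrajLike.mixture hρ fun i => (hP i).toIsTrajLike
  integral_bellmanError k := by
    rw [(integral_mixture fun i _ => (hP i).integrable_bellmanError hQV.measurable_Q
      hQV.measurable_V hQV.Q_mem hQV.V_mem k).2]
    simp [fun i => (hP i).integral_bellmanError k]

/-- With `Q` and `V` fixed, consistency is a linear condition on the law, so it passes from the MDPs
of a group to their convex hull. -/
lemma convex_isConsistent {Pol : Finset (Policy S A)} {π' : Policy S A}
    {f : EuclideanSpace ℝ (Fin d) × EuclideanSpace ℝ (Fin d)}
    {Q : ℕ → S × A → ℝ} {V : ℕ → S → ℝ} (hQV : IsOptimalPair H φ ψ f π' Q V) :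
    Convex ℝ≥0 {N : Pol → Measure (Traj S A H) | ∀ p : Pol, IsConsistent s₁ Q V p (N p)} := by
  intro N₁ h₁ N₂ h₂ a b _ _ hab p
  have hmix : (a • N₁ + b • N₂) p = LinearQV.mixture ![a, b] ![N₁ p, N₂ p] := by
    simp [LinearQV.mixture, Fin.sum_univ_two]
  rw [hmix]
  refine IsConsistent.mixture (by simpa [Fin.sum_univ_two] using hab) hQV fun i => ?_
  fin_cases i
  · exact h₁ p
  · exact h₂ p

/-- The Bellman error as a linear function of the parameter `(θ, w, 1)`. -/
noncomputable def linearBellmanError (φ : ℕ → S → A → EuclideanSpace ℝ (Fin d))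
    (ψ : ℕ → S → EuclideanSpace ℝ (Fin d)) (i : Fin H) :
    EuclideanSpace ℝ (Fin d) × EuclideanSpace ℝ (Fin d) × ℝ →ₗ[ℝ] (Traj S A H → ℝ) where
  toFun x o := inner ℝ (φ i (o i).1 (o i).2.1) x.1 - x.2.2 * (o i).2.2 -
    valueAt (fun h s => inner ℝ (ψ h s) x.2.1) 0 (i + 1) o
  map_add' x y := by
    funext o
    simp only [valueAt, Prod.fst_add, Prod.snd_add, inner_add_right, Pi.add_apply]
    split_ifs <;> ring
  map_smul' c x := by
    funext o
    simp only [valueAt, Prod.smul_fst, Prod.smul_snd, inner_smul_right, Pi.smul_apply,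
      RingHom.id_apply, smul_eq_mul]
    split_ifs <;> simp <;> ring

lemma IsOptimalPair.bellmanError_eq {π : Policy S A}
    {f : EuclideanSpace ℝ (Fin d) × EuclideanSpace ℝ (Fin d)}
    {Q : ℕ → S × A → ℝ} {V : ℕ → S → ℝ} (hQV : IsOptimalPair H φ ψ f π Q V) (i : Fin H) :
    bellmanError Q V i = linearBellmanError φ ψ i (f.1, f.2, 1) := by
  funext o
  simp only [bellmanError, linearBellmanError, LinearMap.coe_mk, AddHom.coe_mk, valueAt, one_mul,
    hQV.Q_eq i i.2]
  split_ifs with hi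
  · rw [hQV.V_eq _ (by omega)]
  · rfl

variable {Pol : Finset (Policy S A)} {N : ι → Pol → Measure (Traj S A H)}
    {f : ι → EuclideanSpace ℝ (Fin d) × EuclideanSpace ℝ (Fin d)} {σ : ι → Pol}
    {Q : ι → ℕ → S × A → ℝ} {V : ι → ℕ → S → ℝ} {ν : Pol → Measure (Traj S A H)}

/-- The expected regret of posterior sampling is that of the optimal policies in the mixture. -/
lemma sum_sub_value_eq (hρ : ∑ i, ρ i = 1)
    (hQV : ∀ i, IsOptimalPair H φ ψ (f i) (σ i) (Q i) (V i))
    (hN : ∀ i (p : Pol), IsConsistent s₁ (Q i) (V i) p (N i p)) :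
    ∑ g, ρ g * ∑ i, ρ i * (V i 0 s₁ - value totalReward (N i) (σ g)) =
      ∑ h, ∑ g, ρ g * ∫ o, bellmanError (Q g) (V g) h o ∂mixture ρ fun i => N i (σ g) := by
  have hρ' : ∑ i, (ρ i : ℝ) = 1 := by exact_mod_cast hρ
  let Mρ : Pol → Measure (Traj S A H) := fun p => mixture ρ fun i => N i p
  have hM : ∀ p : Pol, IsTrajLike s₁ p (Mρ p) := fun p =>
    IsTrajLike.mixture hρ fun i => (hN i p).toIsTrajLike
  have hval : ∀ p, value totalReward Mρ p = ∑ i, ρ i * value totalReward (N i) p := fun p =>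
    (integral_mixture fun i _ => integrable_finsetSum _ fun k _ =>
      (hN i p).integrable_reward k).2
  -- The value is linear in the law. After averaging over `g`, the prior mean of `V i 0 s₁` may be
  -- rewritten with `V g 0 s₁`, which pairs each `σ g` with its own value functions.
  have h1 : ∀ g, ∑ i, ρ i * (V i 0 s₁ - value totalReward (N i) (σ g)) =
      ∑ i, ρ i * V i 0 s₁ - value totalReward Mρ (σ g) := fun g => by
    rw [hval, ← Finset.sum_sub_distrib]
    exact Finset.sum_congr rfl fun i _ => by ring
  rw [Finset.sum_comm]
  simp only [h1, ← Finset.mul_sum]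
  have h2 : ∀ g, ∑ h, ∫ o, bellmanError (Q g) (V g) h o ∂mixture ρ (fun i => N i (σ g)) =
      V g 0 s₁ - value totalReward Mρ (σ g) := fun g =>
    ((hM (σ g)).sub_value_eq_sum_bellmanError (hQV g)).symm
  simp only [h2, mul_sub, Finset.sum_sub_distrib, ← Finset.sum_mul, hρ', one_mul]

/-- The expected Bellman error of the optimal policies, at a given step, is controlled by the
relative entropy collected by posterior sampling. -/
lemma sq_sum_integral_bellmanError_le (hρ : ∑ i, ρ i = 1)
    (hQV : ∀ i, IsOptimalPair H φ ψ (f i) (σ i) (Q i) (V i))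
    (hN : ∀ i (p : Pol), IsConsistent s₁ (Q i) (V i) p (N i p))
    (hν : ∀ p, IsProbabilityMeasure (ν p)) (hkl : ∀ i p, klDiv (N i p) (ν p) ≠ ∞) (h : Fin H) :
    (∑ g, ρ g * ∫ o, bellmanError (Q g) (V g) h o ∂mixture ρ fun i => N i (σ g)) ^ 2 ≤
      (2 * d + 1) * (9 / 2 * ∑ g, ρ g * ∑ i, ρ i * (klDiv (N i (σ g)) (ν (σ g))).toReal) := by
  have hM : ∀ p : Pol, IsTrajLike s₁ p (mixture ρ fun i => N i p) := fun p =>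
    IsTrajLike.mixture hρ fun i => (hN i p).toIsTrajLike
  -- The features carry no measurability or boundedness, so the functional is known to be the
  -- integral only at parameters where the Bellman error is integrable, such as the `f i`.
  choose ℓ hℓ using fun g => exists_linearMap_eq_integral (mixture ρ fun i => N i (σ g))
    (linearBellmanError φ ψ h)
  have hℓ' : ∀ g i, ℓ g ((f i).1, (f i).2, 1) =
      ∫ o, bellmanError (Q i) (V i) h o ∂mixture ρ fun i => N i (σ g) := fun g i => by
    have := (hM (σ g)).integrable_bellmanError (hQV i).measurable_Q (hQV i).measurable_V
      (hQV i).Q_mem (hQV i).V_mem h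
    rw [(hQV i).bellmanError_eq] at this ⊢
    exact hℓ g _ this
  have hmain := sq_sum_apply_le ρ (fun i => ((f i).1, (f i).2, (1 : ℝ))) ℓ
  simp only [hℓ'] at hmain
  refine hmain.trans ?_
  have hrank : (Module.finrank ℝ
      (EuclideanSpace ℝ (Fin d) × EuclideanSpace ℝ (Fin d) × ℝ) : ℝ) = 2 * d + 1 := by
    simp only [Module.finrank_prod, finrank_euclideanSpace, Fintype.card_fin, Module.finrank_self]
    push_cast
    ring
  rw [hrank]
  refine mul_le_mul_of_nonneg_left ?_ (by positivity)
  simp only [← Finset.mul_sum]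
  rw [Finset.mul_sum]
  refine Finset.sum_le_sum fun g _ => ?_
  rw [mul_left_comm]
  refine mul_le_mul_of_nonneg_left ?_ (NNReal.coe_nonneg _)
  have := fun i => (hN i (σ g)).isProbabilityMeasure
  have := hν (σ g)
  have hP := sum_sq_integral_mixture_le hρ (fun i => N i (σ g)) (ν (σ g)) (fun i => hkl i _)
    (X := fun i => bellmanError (Q i) (V i) h) (a := -2) (b := 1) (by norm_num)
    (fun i => measurable_bellmanError (hQV i).measurable_Q (hQV i).measurable_V h)
    (fun i => (hM (σ g)).ae_bellmanError_mem (hQV i).Q_mem (hQV i).V_mem h)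
  -- Under its own model the Bellman error has mean zero, so the deviation is the matrix entry; the
  -- range `[-2, 1]` of length 3 yields the factor `9 / 2`.
  simp only [fun i => (hN i (σ g)).integral_bellmanError h, sub_zero] at hP
  refine hP.trans_eq ?_
  norm_num

/-- Posterior sampling bounds the averaged payoff. -/
lemma sum_payoff_le (hρ : ∑ i, ρ i = 1)
    (hQV : ∀ i, IsOptimalPair H φ ψ (f i) (σ i) (Q i) (V i))
    (hN : ∀ i (p : Pol), IsConsistent s₁ (Q i) (V i) p (N i p))
    (hν : ∀ p, IsProbabilityMeasure (ν p)) (hkl : ∀ i p, klDiv (N i p) (ν p) ≠ ∞)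
    {η : ℝ} (hη : 0 < η) :
    ∑ g, ρ g * ∑ i, ρ i * ((⨆ p, value totalReward (N i) p) - value totalReward (N i) (σ g) -
      (klDiv (N i (σ g)) (ν (σ g))).toReal / η) ≤ 4 * η * d * H ^ 2 := by
  set K := ∑ g, ρ g * ∑ i, ρ i * (klDiv (N i (σ g)) (ν (σ g))).toReal with hK
  have hK0 : 0 ≤ K := Finset.sum_nonneg fun g _ => mul_nonneg (NNReal.coe_nonneg _)
    (Finset.sum_nonneg fun i _ => mul_nonneg (NNReal.coe_nonneg _) ENNReal.toReal_nonneg)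
  have hle : ∑ g, ρ g * ∑ i, ρ i * ((⨆ p, value totalReward (N i) p) -
      value totalReward (N i) (σ g) - (klDiv (N i (σ g)) (ν (σ g))).toReal / η) ≤
      ∑ g, ρ g * ∑ i, ρ i * (V i 0 s₁ - value totalReward (N i) (σ g)) - K / η := by
    rw [hK, Finset.sum_div, ← Finset.sum_sub_distrib]
    refine Finset.sum_le_sum fun g _ => ?_
    rw [mul_div_assoc, ← mul_sub, Finset.sum_div, ← Finset.sum_sub_distrib]
    refine mul_le_mul_of_nonneg_left (Finset.sum_le_sum fun i _ => ?_) (NNReal.coe_nonneg _)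
    rw [mul_div_assoc, ← mul_sub]
    refine mul_le_mul_of_nonneg_left ?_ (NNReal.coe_nonneg _)
    have : Nonempty Pol := ⟨σ g⟩
    have : ⨆ p, value totalReward (N i) p ≤ V i 0 s₁ := ciSup_le fun p => (hN i p).value_le (hQV i)
    linarith
  refine hle.trans ?_
  -- For `d = 0` the factor `2d+1` cannot be absorbed into a multiple of `d`; but then `V 0 s₁ = 0`
  -- and there is no positive regret.
  rcases Nat.eq_zero_or_pos d with rfl | hd
  · have hV : ∀ i, V i 0 s₁ = 0 := fun i => by
      rcases Nat.eq_zero_or_pos H with rfl | hH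
      · exact (hQV i).V_horizon s₁
      · rw [(hQV i).V_eq 0 hH, Subsingleton.elim (f i).2 0, inner_zero_right]
    have h1 : ∑ g, ρ g * ∑ i, ρ i * (V i 0 s₁ - value totalReward (N i) (σ g)) ≤ 0 := by
      refine Finset.sum_nonpos fun g _ => mul_nonpos_of_nonneg_of_nonpos (NNReal.coe_nonneg _)
        (Finset.sum_nonpos fun i _ => mul_nonpos_of_nonneg_of_nonpos (NNReal.coe_nonneg _) ?_)
      have := ((hN i (σ g)).value_mem).1
      rw [hV]
      linarith
    have h2 : 0 ≤ K / η := by positivity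
    simp only [Nat.cast_zero, mul_zero, zero_mul]
    linarith
  · have hd' : (1 : ℝ) ≤ d := by exact_mod_cast hd
    rw [sum_sub_value_eq hρ hQV hN]
    set c : ℝ := (2 * d + 1) * (9 / 2) with hc
    have hc0 : 0 ≤ c := by positivity
    have hstep : ∀ h, ∑ g, ρ g * ∫ o, bellmanError (Q g) (V g) h o ∂mixture ρ (fun i => N i (σ g))
        ≤ √(c * K) := fun h => by
      refine Real.le_sqrt_of_sq_le ?_
      rw [hc, mul_assoc]
      exact sq_sum_integral_bellmanError_le hρ hQV hN hν hkl h
    have hsum := Finset.sum_le_sum fun h (_ : h ∈ Finset.univ) => hstep h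
    rw [Finset.sum_const, Finset.card_univ, Fintype.card_fin, nsmul_eq_mul] at hsum
    have hamgm : H * √(c * K) ≤ K / η + η * H ^ 2 * c / 4 := by
      refine le_of_sq_le_sq ?_ (by positivity)
      rw [mul_pow, Real.sq_sqrt (by positivity)]
      have h1 : K / η * (η * H ^ 2 * c / 4) * 4 = H ^ 2 * (c * K) := by
        field_simp
      nlinarith [sq_nonneg (K / η - η * H ^ 2 * c / 4)]
    -- `c / 4 = (2d+1) * 9/8 ≤ 27d/8`, as `d ≥ 1`.
    have hcd : c / 4 ≤ 4 * d := by rw [hc]; linarith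
    have hfin : η * H ^ 2 * c / 4 ≤ 4 * η * d * H ^ 2 := by
      have := mul_le_mul_of_nonneg_left hcd (show 0 ≤ η * (H : ℝ) ^ 2 by positivity)
      calc η * H ^ 2 * c / 4 = η * H ^ 2 * (c / 4) := by ring
        _ ≤ _ := this
        _ = _ := by ring
    linarith

end PosteriorSampling

/-! ### Optimal value functions of an MDP and the models in a group -/

section ValueFunctions

variable {S A : Type*} [MeasurableSpace S] [MeasurableSpace A]

lemma measurable_rewardToGo (M : MDP S A) (π : Policy S A) (n h : ℕ) :
    Measurable (M.rewardToGo π n h) := by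
  induction n generalizing h with
  | zero => exact measurable_const
  | succ n ih =>
    have hact := π.measurable_act h
    have hR := M.measurable_R h
    have hint : Measurable fun s => ∫ s', M.rewardToGo π n (h + 1) s' ∂(M.next π h s) :=
      ((ih (h + 1)).stronglyMeasurable.integral_kernel (κ := M.next π h)).measurable
    exact (hR.comp (measurable_id.prodMk hact)).add hint

lemma rewardToGo_nonneg (M : MDP S A) (π : Policy S A) (n h : ℕ) (s : S) :
    0 ≤ M.rewardToGo π n h s := by
  induction n generalizing h s with
  | zero => exact le_rfl
  | succ n ih =>
    exact add_nonneg (M.R_mem h _).1 (integral_nonneg fun s' => ih (h + 1) s')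

lemma rewardToGo_congr (M : MDP S A) {π π' : Policy S A} (n : ℕ) {h : ℕ}
    (hact : ∀ k, h ≤ k → π.act k = π'.act k) :
    M.rewardToGo π n h = M.rewardToGo π' n h := by
  induction n generalizing h with
  | zero => rfl
  | succ n ih =>
    funext s
    have hnext : M.rewardToGo π n (h + 1) = M.rewardToGo π' n (h + 1) :=
      ih fun k hk => hact k (by omega)
    simp only [MDP.rewardToGo, MDP.next, Kernel.comap_apply, hact h le_rfl, hnext]

lemma V_eq_Q_act (M : MDP S A) {H h : ℕ} (hh : h < H) (π : Policy S A) (s : S) :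
    M.V H π h s = M.Q H π h s (π.act h s) := by
  obtain ⟨n, hn⟩ : ∃ n, H - h = n + 1 := ⟨H - h - 1, by omega⟩
  have hn' : H - (h + 1) = n := by omega
  simp only [MDP.V, MDP.Q, hn, hn', MDP.rewardToGo, MDP.next, Kernel.comap_apply]

lemma V_of_ge (M : MDP S A) {H h : ℕ} (hh : H ≤ h) (π : Policy S A) (s : S) :
    M.V H π h s = 0 := by
  simp [MDP.V, Nat.sub_eq_zero_of_le hh, MDP.rewardToGo]

lemma V_nonneg (M : MDP S A) (H h : ℕ) (π : Policy S A) (s : S) : 0 ≤ M.V H π h s :=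
  rewardToGo_nonneg M π _ h s

lemma Q_nonneg (M : MDP S A) (H h : ℕ) (π : Policy S A) (s : S) (a : A) :
    0 ≤ M.Q H π h s a :=
  add_nonneg (M.R_mem h _).1 (integral_nonneg fun s' => V_nonneg M H _ π s')

/-- The policy that plays the action `a` at step `h`, and follows `π` otherwise. -/
noncomputable def Policy.update (π : Policy S A) (h : ℕ) (a : A) : Policy S A where
  act := Function.update π.act h fun _ => a
  measurable_act k := by
    by_cases hk : k = h
    · subst hk
      simp
    · rw [Function.update_of_ne hk]
      exact π.measurable_act k

/-- One-step deviation: playing `a` at step `h` and then following `π` is itself a policy, whose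
value at `s` is the left side. -/
lemma MDP.IsOptimal.Q_le_V {M : MDP S A} {H : ℕ} {π : Policy S A} (hopt : M.IsOptimal H π)
    {h : ℕ} (hh : h < H) (s : S) (a : A) : M.Q H π h s a ≤ M.V H π h s := by
  refine le_trans (le_of_eq ?_) (hopt (π.update h a) h hh s)
  rw [V_eq_Q_act M hh]
  have hact : (π.update h a).act h s = a := by simp [Policy.update]
  have hV : M.V H (π.update h a) (h + 1) = M.V H π (h + 1) := by
    unfold MDP.V
    refine rewardToGo_congr M _ fun k hk => ?_
    simp only [Policy.update]
    exact Function.update_of_ne (by omega) _ _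
  simp only [MDP.Q, hact, hV]

/-- The optimal value functions of a normalized MDP with linear parameters. -/
lemma MDP.HasParam.isOptimalPair {M : MDP S A} {H d : ℕ} {s₁ : S} {π : Policy S A}
    {φ : ℕ → S → A → EuclideanSpace ℝ (Fin d)} {ψ : ℕ → S → EuclideanSpace ℝ (Fin d)}
    {f : EuclideanSpace ℝ (Fin d) × EuclideanSpace ℝ (Fin d)} (hf : M.HasParam H π φ ψ f)
    (hopt : M.IsOptimal H π) (hnorm : M.Normalized H s₁) :
    IsOptimalPair H φ ψ f π (fun h x => M.Q H π h x.1 x.2) (M.V H π) where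
  measurable_V h := measurable_rewardToGo M π _ h
  measurable_Q h := by
    have := M.markov h
    exact (M.measurable_R h).add ((measurable_rewardToGo M π _ _).stronglyMeasurable.integral_kernel
      (κ := M.P h)).measurable
  Q_mem h x := by
    refine ⟨Q_nonneg M H h π x.1 x.2, ?_⟩
    rcases Nat.lt_or_ge h H with hh | hh
    · exact hnorm.2 π h hh x.1 x.2
    · simp [MDP.Q, V_of_ge M (show H ≤ h + 1 by omega), (M.R_mem h x).2]
  V_mem h s := by
    refine ⟨V_nonneg M H h π s, ?_⟩
    rcases Nat.lt_or_ge h H with hh | hh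
    · rw [V_eq_Q_act M hh]
      exact hnorm.2 π h hh s _
    · simp [V_of_ge M hh]
  V_horizon s := V_of_ge M le_rfl π s
  Q_le h hh s a := hopt.Q_le_V hh s a
  Q_act h hh s := (V_eq_Q_act M hh π s).symm
  Q_eq h hh s a := (hf h hh s).1 a
  V_eq h hh s := (hf h hh s).2

/-- Every mixture of models within a group is consistent with linear optimal value functions. -/
lemma exists_isConsistent_of_mem_convexification {H d : ℕ} {s₁ : S} {Pol : Finset (Policy S A)}
    {models : Set (MDP S A)} (hnorm : ∀ M ∈ models, M.Normalized H s₁)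
    {opt : MDP S A → Pol} (hopt : ∀ M ∈ models, M.IsOptimal H (opt M))
    {φ : ℕ → S → A → EuclideanSpace ℝ (Fin d)} {ψ : ℕ → S → EuclideanSpace ℝ (Fin d)}
    {F : Finset (EuclideanSpace ℝ (Fin d) × EuclideanSpace ℝ (Fin d))}
    {N : Pol → Measure (Traj S A H)}
    (hN : N ∈ convexification (fun (M : MDP S A) (π : Pol) => M.trajLaw H s₁ π) models
      {g | ∃ f ∈ F, g = group H models opt φ ψ f}) :
    ∃ (f : EuclideanSpace ℝ (Fin d) × EuclideanSpace ℝ (Fin d)) (σ : Pol) (Q : ℕ → S × A → ℝ)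
      (V : ℕ → S → ℝ), IsOptimalPair H φ ψ f σ Q V ∧ ∀ p : Pol, IsConsistent s₁ Q V p (N p) := by
  simp only [convexification, Set.mem_iUnion] at hN
  obtain ⟨_, ⟨f, _, rfl⟩, hN⟩ := hN
  -- Any member `M₀` of the group supplies `Q`, `V` and the greedy policy for the whole hull, since
  -- the parameter determines the value functions below `H`.
  obtain ⟨_, M₀, ⟨-, π₀, hM₀, -, hf₀⟩, -⟩ := convexHull_nonempty_iff.1 ⟨N, hN⟩
  have hpair := hf₀.isOptimalPair (hopt M₀ hM₀) (hnorm M₀ hM₀)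
  refine ⟨f, opt M₀, _, _, hpair, ?_⟩
  refine convexHull_min ?_ (convex_isConsistent hpair) hN
  rintro _ ⟨M, ⟨-, π, hM, -, hf⟩, rfl⟩ p
  refine isConsistent_trajLaw M _ hpair (σ := opt M) (fun h hh s a => ?_) fun h hh s => ?_
  · exact ((hf h hh s).1 a).trans ((hf₀ h hh s).1 a).symm
  · exact (hf h hh s).2.trans (hf₀ h hh s).2.symm

end ValueFunctions

/-! ### Minimax reduction for the extended-real payoff -/

section Payoff

variable {Pol O : Type*} [Fintype Pol] [MeasurableSpace O] {rew : O → ℝ} {η : ℝ}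
    {Mbar M : Pol → Measure O} {p : Pol → ℝ}

lemma decPayoff_eq_bot (hη : 0 < η) (hp : ∀ π, 0 < p π) {π : Pol}
    (hkl : klDiv (M π) (Mbar π) = ∞) : decPayoff rew η Mbar M p = ⊥ := by
  have htop : ∑ π, ENNReal.ofReal (p π / η) * klDiv (M π) (Mbar π) = ∞ := by
    refine ENNReal.sum_eq_top.2 ⟨π, Finset.mem_univ _, ?_⟩
    rw [hkl]
    exact ENNReal.mul_top (by simpa using div_pos (hp π) hη)
  rw [decPayoff, htop, EReal.coe_ennreal_top, EReal.sub_top]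

lemma decPayoff_eq_coe (hη : 0 < η) (hp : ∀ π, 0 ≤ p π)
    (hkl : ∀ π, klDiv (M π) (Mbar π) ≠ ∞) :
    decPayoff rew η Mbar M p = ((∑ π, p π * ((⨆ π', value rew M π') - value rew M π -
      (klDiv (M π) (Mbar π)).toReal / η) : ℝ) : EReal) := by
  have hterm : ∀ π, ENNReal.ofReal (p π / η) * klDiv (M π) (Mbar π) =
      ENNReal.ofReal (p π * ((klDiv (M π) (Mbar π)).toReal / η)) := fun π => by
    conv_lhs => rw [← ENNReal.ofReal_toReal (hkl π)]
    rw [← ENNReal.ofReal_mul (div_nonneg (hp π) hη.le)]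
    congr 1
    ring
  have hnn : ∀ π, 0 ≤ p π * ((klDiv (M π) (Mbar π)).toReal / η) := fun π =>
    mul_nonneg (hp π) (div_nonneg ENNReal.toReal_nonneg hη.le)
  rw [decPayoff]
  simp only [hterm]
  rw [← ENNReal.ofReal_sum_of_nonneg fun π _ => hnn π, EReal.coe_ennreal_ofReal,
    max_eq_left (Finset.sum_nonneg fun π _ => hnn π), ← EReal.coe_sub, ← Finset.sum_sub_distrib]
  simp only [← mul_sub]

/-- If the payoff vectors of all finite mixtures of models at finite relative entropy have an entry
bounded by `C`, then the inner minimax value is at most `C`. -/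
lemma iInf_iSup_decPayoff_le [Nonempty Pol] {models : Set (Pol → Measure O)} (hη : 0 < η) {C L : ℝ}
    (hL : 0 ≤ L) (hC : 0 ≤ C) (hbd : ∀ M ∈ models, ∀ π, (⨆ π', value rew M π') - value rew M π ≤ L)
    (h : ∀ v ∈ convexHull ℝ {v : Pol → ℝ | ∃ M ∈ models, (∀ π, klDiv (M π) (Mbar π) ≠ ∞) ∧
      v = fun π => (⨆ π', value rew M π') - value rew M π - (klDiv (M π) (Mbar π)).toReal / η},
      ∃ π, v π ≤ C) :
    ⨅ p ∈ stdSimplex ℝ Pol, ⨆ M ∈ models, decPayoff rew η Mbar M p ≤ (C : EReal) := by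
  obtain ⟨q, hq, hqT⟩ := exists_stdSimplex_forall_sum_le h
  refine EReal.le_of_forall_lt_iff_le.1 fun z hz => ?_
  have hz' : C < z := EReal.coe_lt_coe_iff.1 hz
  -- Mixing `δ` of the uniform distribution into `q` gives every policy positive mass, so models at
  -- infinite relative entropy have payoff `⊥`; for the others the cost is at most `δ * L`, within
  -- the slack `z - C`.
  obtain ⟨δ, hδ0, hδ1, hδ⟩ : ∃ δ : ℝ, 0 < δ ∧ δ ≤ 1 ∧ δ * L ≤ z - C := by
    refine ⟨min 1 ((z - C) / (L + 1)), lt_min one_pos (div_pos (by linarith) (by linarith)),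
      min_le_left _ _, ?_⟩
    calc min 1 ((z - C) / (L + 1)) * L ≤ (z - C) / (L + 1) * (L + 1) :=
          mul_le_mul (min_le_right _ _) (by linarith) hL
            (div_nonneg (by linarith) (by linarith))
      _ = z - C := div_mul_cancel₀ _ (by linarith)
  have hcard : (0 : ℝ) < Fintype.card Pol := by exact_mod_cast Fintype.card_pos
  let u : Pol → ℝ := fun _ => (Fintype.card Pol : ℝ)⁻¹
  have hu1 : ∑ π, u π = 1 := by simp [u, hcard.ne']
  let p : Pol → ℝ := fun π => (1 - δ) * q π + δ * u π
  have hp0 : ∀ π, 0 < p π := fun π =>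
    add_pos_of_nonneg_of_pos (mul_nonneg (by linarith) (hq.1 π)) (mul_pos hδ0 (inv_pos.2 hcard))
  have hp : p ∈ stdSimplex ℝ Pol := by
    refine ⟨fun π => (hp0 π).le, ?_⟩
    simp only [p, Finset.sum_add_distrib, ← Finset.mul_sum, hq.2, hu1]
    ring
  refine (iInf₂_le p hp).trans (iSup₂_le fun M hM => ?_)
  by_cases hkl : ∀ π, klDiv (M π) (Mbar π) ≠ ∞
  · rw [decPayoff_eq_coe hη (fun π => (hp0 π).le) hkl, EReal.coe_le_coe_iff]
    set v : Pol → ℝ := fun π =>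
      (⨆ π', value rew M π') - value rew M π - (klDiv (M π) (Mbar π)).toReal / η with hv
    have h1 : ∑ π, q π * v π ≤ C := hqT v ⟨M, hM, hkl, rfl⟩
    have hvL : ∀ π, v π ≤ L := fun π => by
      have := hbd M hM π
      have h0 : 0 ≤ (klDiv (M π) (Mbar π)).toReal / η := div_nonneg ENNReal.toReal_nonneg hη.le
      simp only [hv]
      linarith
    have h2 : ∑ π, u π * v π ≤ L := by
      calc ∑ π, u π * v π ≤ ∑ π, u π * L := Finset.sum_le_sum fun π _ =>
            mul_le_mul_of_nonneg_left (hvL π) (inv_pos.2 hcard).le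
        _ = L := by rw [← Finset.sum_mul, hu1, one_mul]
    have h3 : ∑ π, p π * v π = (1 - δ) * ∑ π, q π * v π + δ * ∑ π, u π * v π := by
      rw [Finset.mul_sum, Finset.mul_sum, ← Finset.sum_add_distrib]
      exact Finset.sum_congr rfl fun π _ => by simp only [p]; ring
    rw [h3]
    have h4 := mul_le_mul_of_nonneg_left h1 (show 0 ≤ 1 - δ by linarith)
    have h5 := mul_le_mul_of_nonneg_left h2 hδ0.le
    nlinarith
  · push Not at hkl
    obtain ⟨π, hπ⟩ := hkl
    rw [decPayoff_eq_bot hη hp0 hπ]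
    exact bot_le

end Payoff

/-- The models given by probability measures form a convex set. -/
lemma convex_isProbabilityMeasure {Pol O : Type*} [MeasurableSpace O] :
    Convex ℝ≥0 {N : Pol → Measure O | ∀ p, IsProbabilityMeasure (N p)} := by
  intro N₁ h₁ N₂ h₂ a b _ _ hab p
  have := h₁ p
  have := h₂ p
  constructor
  simp only [Pi.add_apply, Pi.smul_apply, Measure.add_apply, Measure.smul_apply, measure_univ,
    ENNReal.smul_def, smul_eq_mul, mul_one]
  exact_mod_cast hab

end LinearQV

/-! ### The bound on the coefficient -/

open LinearQV in
theorem theorem6 {S A : Type*} [MeasurableSpace S] [MeasurableSpace A] (H d : ℕ) (s₁ : S)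
    -- the finite policy class, the finite class of MDPs, and the optimal policies `π_M`
    (Pol : Finset (Policy S A)) (models : Set (MDP S A)) (hfin : models.Finite)
    (hnorm : ∀ M ∈ models, M.Normalized H s₁)
    (opt : MDP S A → Pol) (hopt : ∀ M ∈ models, M.IsOptimal H (opt M))
    -- the features and the function class
    (φ : ℕ → S → A → EuclideanSpace ℝ (Fin d)) (ψ : ℕ → S → EuclideanSpace ℝ (Fin d))
    (F : Finset (EuclideanSpace ℝ (Fin d) × EuclideanSpace ℝ (Fin d)))
    (hlin : ∀ M ∈ models, ∃ f ∈ F, M.HasParam H (opt M) φ ψ f)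
    (η : ℝ) (hη : 0 < η) :
    decKL (Pol := Pol) totalReward η
        (convexification (fun (M : MDP S A) (π : Pol) => M.trajLaw H s₁ π) models
          {g | ∃ f ∈ F, g = group H models opt φ ψ f})
      ≤ ((4 * η * d * H ^ 2 : ℝ) : EReal) := by
  have hcons := fun N => exists_isConsistent_of_mem_convexification (N := N) (F := F) (φ := φ)
    (ψ := ψ) hnorm hopt
  refine iSup₂_le fun Mbar hMbar => ?_
  obtain ⟨N₀, hN₀⟩ := convexHull_nonempty_iff.1 ⟨Mbar, hMbar⟩
  obtain ⟨_, σ₀, -⟩ := hcons N₀ hN₀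
  have : Nonempty Pol := ⟨σ₀⟩
  have hprob : ∀ p, IsProbabilityMeasure (Mbar p) :=
    convexHull_min (fun N hN p => by
      obtain ⟨_, _, _, _, -, h⟩ := hcons N hN
      exact (h p).isProbabilityMeasure) convex_isProbabilityMeasure hMbar
  refine iInf_iSup_decPayoff_le hη (L := H) (by positivity) (by positivity) (fun M hM π => ?_) ?_
  · obtain ⟨_, _, _, _, -, h⟩ := hcons M hM
    have h1 : ⨆ π', value totalReward M π' ≤ H := ciSup_le fun p => ((h p).value_mem).2
    linarith [((h π).value_mem).1]
  · intro v hv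
    obtain ⟨ι, _, w, z, hw₀, hw₁, hz, rfl⟩ := mem_convexHull_iff_exists_fintype.1 hv
    choose N hN hkl hz using hz
    choose f σ Q V hQV hC using fun i => hcons (N i) (hN i)
    lift w to ι → ℝ≥0 using hw₀
    have hw : ∑ i, w i = 1 := NNReal.eq (by simpa using hw₁)
    have key := sum_payoff_le hw hQV hC hprob hkl hη
    have hv' : ∀ g, ∑ i, w i * ((⨆ p, value totalReward (N i) p) - value totalReward (N i) (σ g) -
        (InformationTheory.klDiv (N i (σ g)) (Mbar (σ g))).toReal / η) =
        (∑ i, (w i : ℝ) • z i) (σ g) := fun g => by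
      simp [Finset.sum_apply, hz]
    simp only [hv'] at key
    -- If every entry exceeded the bound, so would the `ρ`-average over the policies `σ g`, contrary
    -- to `key`.
    by_contra hlt
    push Not at hlt
    obtain ⟨g, -, hg⟩ := Finset.exists_ne_zero_of_sum_ne_zero (hw.trans_ne one_ne_zero)
    refine absurd key (not_le.2 ?_)
    calc 4 * η * d * H ^ 2 = ∑ g, w g * (4 * η * d * H ^ 2) := by
          rw [← Finset.sum_mul, hw₁, one_mul]
      _ < _ := Finset.sum_lt_sum
          (fun g _ => mul_le_mul_of_nonneg_left (hlt (σ g)).le (NNReal.coe_nonneg _))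
          ⟨g, Finset.mem_univ _, mul_lt_mul_of_pos_left (hlt (σ g))
            (NNReal.coe_pos.2 (pos_iff_ne_zero.2 hg))⟩
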